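/- Let $d\ge 1$ be an integer, $\hbar>0$, $h=2\pi\hbar$, $\beta>0$, and let $n$ be a real number with $n>-d$. On $L^2(\mathbb R^d;\mathbb C)$ let $\mathsf p=-i\hbar\nabla$, let $H=\tfrac12(|\mathsf p|^2+|x|^2)$ be the (self-adjoint) harmonic oscillator Hamiltonian, put $Z_\beta=h^d\operatorname{tr}(e^{-\beta H})$, and let $g_\beta=Z_\beta^{-1}e^{-\beta H}$ be the thermal state. Let $\theta(x)=\tanh(x)/x$ for $x>0$. Then $$h^d\operatorname{tr}(|x|^n g_\beta)=h^d\operatorname{tr}(|\mathsf p|^n g_\beta)=\frac{\Gamma\big(\tfrac{d+n}{2}\big)}{\Gamma\big(\tfrac d2\big)}\Big(\frac{\beta\,\theta(\beta\hbar/2)}{2}\Big)^{-n/2}.$$ Here, for $A=|x|^n$ or $A=|\mathsf p|^n$, $\operatorname{tr}(A g_\beta)$ is understood as $\operatorname{tr}(S^*S)$ with $S=A^{1/2}g_\beta^{1/2}$; the operator $S$ is everywhere defined and bounded, and $S^*S$ is trace class. If moreover $n>-d/2$, then $A g_\beta$ itself is an everywhere defined, bounded, trace class operator, and its trace has the same value.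 -/

import Mathlib

open MeasureTheory SchwartzMap
open scoped FourierTransform LineDeriv ENNReal InnerProductSpace

noncomputable section

namespace ThermalState

/-! ## Functional calculus and traces on a complex Hilbert space -/

section Hilbert

variable {E : Type} [NormedAddCommGroup E] [InnerProductSpace ℂ E] [CompleteSpace E]

/-- `G = φ(A)` for a (possibly unbounded) self-adjoint operator `A`, in the sense of the
multiplication-operator form of the spectral theorem: some unitary `U` onto an `L²(α, μ)` carries
`A` to the maximal operator of multiplication by a real measurable function `f`, and carries the
bounded operator `G` to multiplication by `φ ∘ f`. (For Borel `φ` such a `G` does not depend on the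
chosen representation.) -/
def IsFunctionOf (φ : ℝ → ℝ) (A : E →ₗ.[ℂ] E) (G : E →L[ℂ] E) : Prop :=
  ∃ (α : Type) (_ : MeasurableSpace α) (μ : Measure α) (f : α → ℝ) (U : E ≃ₗᵢ[ℂ] Lp ℂ 2 μ),
    Measurable f ∧
    (∀ ψ : E, ψ ∈ A.domain ↔ MemLp (fun a => (f a : ℂ) * U ψ a) 2 μ) ∧
    (∀ ψ : A.domain, U (A ψ) =ᵐ[μ] fun a => (f a : ℂ) * U (ψ : E) a) ∧
    (∀ ψ : E, U (G ψ) =ᵐ[μ] fun a => (φ (f a) : ℂ) * U ψ a)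

open Classical in
/-- The bounded operator `e^{-β A}` of a self-adjoint operator `A` that is bounded below
(and `0` where it does not exist as a bounded operator). -/
def expNeg (β : ℝ) (A : E →ₗ.[ℂ] E) : E →L[ℂ] E :=
  if h : ∃ G, IsFunctionOf (fun t => Real.exp (-β * t)) A G then h.choose else 0

/-- The bounded operator `T` is trace class with trace `τ`: for every orthonormal basis `(bᵢ)` the
series `∑ᵢ ⟨bᵢ, T bᵢ⟩` converges unconditionally, with sum `τ`. -/
def HasTrace (T : E →L[ℂ] E) (τ : ℂ) : Prop :=
  ∀ (ι : Type) (b : HilbertBasis ι ℂ E), HasSum (fun i => ⟪b i, T (b i)⟫_ℂ) τ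

open Classical in
/-- The trace of a trace class operator (and `0` for any other bounded operator). -/
def trace (T : E →L[ℂ] E) : ℂ :=
  if h : ∃ τ, HasTrace T τ then h.choose else 0

/-- The product `A g` of an unbounded operator `A` and a bounded operator `g` is an
everywhere defined, bounded, trace class operator, and its trace is `τ`. -/
def HasTraceMul (A : E →ₗ.[ℂ] E) (g : E →L[ℂ] E) (τ : ℂ) : Prop :=
  ∃ T : E →L[ℂ] E, (∀ ψ : E, ∃ h : g ψ ∈ A.domain, T ψ = A ⟨g ψ, h⟩) ∧ HasTrace T τ

/-- The trace of `A g` for a nonnegative self-adjoint operator `A = R²` and a nonnegative bounded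
operator `g`, in the usual symmetrized sense
`tr(A g) = tr(g^{1/2} A g^{1/2}) = tr((R g^{1/2})^* (R g^{1/2}))`:
the operator `S = R g^{1/2}` is everywhere defined and bounded, and `S^* S` is trace class with
trace `τ`. It makes sense also where `A g` itself is not defined on the whole space. The argument
is the nonnegative square root `R` of `A`. -/
def HasSymmTraceMul (R : E →ₗ.[ℂ] E) (g : E →L[ℂ] E) (τ : ℂ) : Prop :=
  ∃ S : E →L[ℂ] E, (∀ ψ : E, ∃ h : CFC.sqrt g ψ ∈ R.domain, S ψ = R ⟨CFC.sqrt g ψ, h⟩) ∧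
    HasTrace (ContinuousLinearMap.adjoint S ∘L S) τ

end Hilbert

/-! ## Position, momentum and the harmonic oscillator on `L²(ℝᵈ)` -/

/-- The configuration space `ℝᵈ` with its Euclidean norm. -/
abbrev Space (d : ℕ) : Type := EuclideanSpace ℝ (Fin d)

/-- The one-particle Hilbert space `L²(ℝᵈ; ℂ)`. -/
abbrev L2 (d : ℕ) : Type := Lp ℂ 2 (volume : Measure (Space d))

/-- The `j`-th position operator `φ ↦ x_j φ` on Schwartz functions. -/
def position (d : ℕ) (j : Fin d) : 𝓢(Space d, ℂ) →L[ℂ] 𝓢(Space d, ℂ) :=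
  smulLeftCLM ℂ (fun x : Space d => ((x j : ℝ) : ℂ))

/-- The `j`-th momentum operator `φ ↦ -iħ ∂_j φ` on Schwartz functions. -/
def momentum (d : ℕ) (ħ : ℝ) (j : Fin d) : 𝓢(Space d, ℂ) →L[ℂ] 𝓢(Space d, ℂ) :=
  (-Complex.I * (ħ : ℂ)) •
    LineDeriv.lineDerivOpCLM ℂ 𝓢(Space d, ℂ) (EuclideanSpace.single j (1 : ℝ))

/-- The differential expression `(|p|² + |x|²) / 2` on Schwartz functions. -/
def oscillatorSchwartz (d : ℕ) (ħ : ℝ) : 𝓢(Space d, ℂ) →L[ℂ] 𝓢(Space d, ℂ) :=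
  (1 / 2 : ℂ) • ∑ j : Fin d,
    (momentum d ħ j ∘L momentum d ħ j + position d j ∘L position d j)

/-- The inclusion of the Schwartz functions in `L²(ℝᵈ)`. -/
def schwartzIncl (d : ℕ) : 𝓢(Space d, ℂ) →ₗ[ℂ] L2 d :=
  (toLpCLM ℂ (E := Space d) ℂ 2 volume).toLinearMap

theorem schwartzIncl_injective (d : ℕ) : Function.Injective (schwartzIncl d) :=
  injective_toLp (E := Space d) (F := ℂ) 2 volume

/-- The harmonic oscillator as an unbounded operator in `L²(ℝᵈ)` with domain the Schwartz space. -/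
def oscillatorMin (d : ℕ) (ħ : ℝ) : L2 d →ₗ.[ℂ] L2 d where
  domain := LinearMap.range (schwartzIncl d)
  toFun := schwartzIncl d ∘ₗ (oscillatorSchwartz d ħ).toLinearMap ∘ₗ
    (LinearEquiv.ofInjective (schwartzIncl d) (schwartzIncl_injective d)).symm.toLinearMap

/-- The self-adjoint harmonic oscillator Hamiltonian `H = (|p|² + |x|²) / 2` in `L²(ℝᵈ)`. The
operator on the Schwartz space is essentially self-adjoint, so `H` is its adjoint: `H ψ = η` means
that `ψ, η ∈ L²` and `(|p|² + |x|²) ψ / 2 = η` in the sense of tempered distributions. -/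
def hamiltonian (d : ℕ) (ħ : ℝ) : L2 d →ₗ.[ℂ] L2 d :=
  (oscillatorMin d ħ).adjoint

theorem mul_add_ae {d : ℕ} {w : Space d → ℝ} (ψ η : L2 d) :
    (fun x => (w x : ℂ) * (ψ + η : L2 d) x) =ᵐ[volume]
      (fun x => (w x : ℂ) * ψ x) + fun x => (w x : ℂ) * η x := by
  filter_upwards [Lp.coeFn_add ψ η] with x hx
  simp only [Pi.add_apply] at hx ⊢
  rw [hx, mul_add]

theorem mul_smul_ae {d : ℕ} {w : Space d → ℝ} (c : ℂ) (ψ : L2 d) :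
    (fun x => (w x : ℂ) * (c • ψ : L2 d) x) =ᵐ[volume] c • fun x => (w x : ℂ) * ψ x := by
  filter_upwards [Lp.coeFn_smul c ψ] with x hx
  simp only [Pi.smul_apply, smul_eq_mul] at hx ⊢
  rw [hx]; ring

/-- The maximal operator of multiplication by the real function `w` in `L²(ℝᵈ)`. -/
def mulOp (d : ℕ) (w : Space d → ℝ) : L2 d →ₗ.[ℂ] L2 d where
  domain :=
    { carrier := {ψ | MemLp (fun x => (w x : ℂ) * ψ x) 2 volume}
      zero_mem' := by
        refine (MemLp.zero' (ε := ℂ)).ae_eq ?_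
        filter_upwards [Lp.coeFn_zero ℂ 2 (volume : Measure (Space d))] with x hx
        rw [hx, Pi.zero_apply, mul_zero]
      add_mem' := fun hψ hη => (hψ.add hη).ae_eq (mul_add_ae _ _).symm
      smul_mem' := fun c ψ hψ => (hψ.const_smul c).ae_eq (mul_smul_ae c ψ).symm }
  toFun :=
    { toFun := fun ψ => MemLp.toLp _ ψ.2
      map_add' := fun ψ η => by
        rw [← MemLp.toLp_add]
        exact MemLp.toLp_congr _ _ (mul_add_ae (ψ : L2 d) (η : L2 d))
      map_smul' := fun c ψ => by
        rw [RingHom.id_apply, ← MemLp.toLp_const_smul]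
        exact MemLp.toLp_congr _ _ (mul_smul_ae c (ψ : L2 d)) }

/-- The maximal Fourier multiplier `ψ ↦ 𝓕⁻¹ (w · 𝓕 ψ)` in `L²(ℝᵈ)`, with
`𝓕 ψ (ξ) = ∫ e^{-2πi⟨x, ξ⟩} ψ(x) dx`. -/
def fourierMulOp (d : ℕ) (w : Space d → ℝ) : L2 d →ₗ.[ℂ] L2 d where
  domain := (mulOp d w).domain.comap
    (Lp.fourierTransformₗᵢ (Space d) ℂ).toLinearEquiv.toLinearMap
  toFun := (Lp.fourierTransformₗᵢ (Space d) ℂ).symm.toLinearEquiv.toLinearMap ∘ₗ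
    (mulOp d w).toFun ∘ₗ
      ((Lp.fourierTransformₗᵢ (Space d) ℂ).toLinearEquiv.toLinearMap.restrict
        (p := (mulOp d w).domain.comap
          (Lp.fourierTransformₗᵢ (Space d) ℂ).toLinearEquiv.toLinearMap)
        (q := (mulOp d w).domain) fun _ h => h)

/-- The operator `|x|^s`, for real `s`. -/
def absPositionPow (d : ℕ) (s : ℝ) : L2 d →ₗ.[ℂ] L2 d :=
  mulOp d fun x => ‖x‖ ^ s

/-- The operator `|p|^s`, for real `s`, where `p = -iħ∇`. With the above normalization of the
Fourier transform, `p` is the Fourier multiplier by `2πħ ξ`. -/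
def absMomentumPow (d : ℕ) (ħ s : ℝ) : L2 d →ₗ.[ℂ] L2 d :=
  fourierMulOp d fun ξ => ‖(2 * Real.pi * ħ) • ξ‖ ^ s

/-! ## The thermal state -/

/-- Planck's constant `h = 2πħ`. -/
def planck (ħ : ℝ) : ℝ := 2 * Real.pi * ħ

/-- The partition function `Z_β = h^d tr(e^{-βH})`. -/
def partitionFunction (d : ℕ) (ħ β : ℝ) : ℂ :=
  (planck ħ : ℂ) ^ d * trace (expNeg β (hamiltonian d ħ))

/-- The thermal state `g_β = Z_β⁻¹ e^{-βH}`. -/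
def thermalState (d : ℕ) (ħ β : ℝ) : L2 d →L[ℂ] L2 d :=
  (partitionFunction d ħ β)⁻¹ • expNeg β (hamiltonian d ħ)

/-- `θ(x) = tanh(x) / x` (used for `x > 0`). -/
def theta (x : ℝ) : ℝ := Real.tanh x / x

end ThermalState

end

noncomputable section

namespace ThermalState

/-! ### Traces and functional calculus of diagonal operators. -/

section Hilbert

variable {E : Type} [NormedAddCommGroup E] [InnerProductSpace ℂ E]
variable {κ : Type}

/-! Everything is diagonal in the Hermite basis `u k`, built from the Gaussian by raising operators
`s x_j - t ∂_j` with `t = ħ s`, `2 s t = 1`. The Hamiltonian has eigenvalue `ħ (|k| + d/2)` on `u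
k`, so `thermalState` acts there by `r ^ |k| / (h ^ d Z)`, with `r = exp (-βħ)` and `Z = ∑ r ^ |k|`.
The trace of `|x|^n g` is therefore the `n`-th absolute moment of the density `∑ r ^ |k| |u k|²`,
divided by `h ^ d Z`.

The heart of the proof is that this density is Gaussian, which is found without Mehler's kernel. Let
`F ξ = ∑ r ^ |k| ⟨u k, exp (i⟨ξ, x⟩) u k⟩` be its characteristic function. Shifting `k` by a unit
vector and commuting a ladder operator through the plane wave expresses the same sum with an extra
`x_j` as `i γ ξ_j F ξ`, where `γ = t / (2 s) * (1 + r) / (1 - r)` (`IsLadder.tsum_lowering`,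
`IsLadder.tsum_raising`, `IsLadder.hasSum_position`). Along each ray this is a linear ODE, with
solution `F ξ = Z exp (-γ |ξ|² / 2)` (`IsLadder.tsum_waveInner`). Uniqueness of characteristic
functions identifies the density (`IsLadder.thermalMeasure_eq`), and polar coordinates give its
moments.

Momentum needs no second computation: the Fourier transform carries a ladder family to a ladder
family with other constants and a phase (`IsLadder.fourier`), and `IsLadder` is stated generally
enough to cover both.

On the operator side, `r ^ |k|` decays geometrically, so all operators that occur are nuclear sums
over the basis. Since multiplication operators are closed, their product with `g` or its square root
is defined everywhere (`exists_mul_of_diagonal`). The thresholds on `n` are exactly what puts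
`|x|^(n/2) u k`, respectively `|x|^n u k`, in `L²`. -/

theorem summable_norm_inner_mul_inner {ι : Type} (b : HilbertBasis ι ℂ E) (x y : E) :
    Summable (fun i => ‖⟪x, b i⟫_ℂ * ⟪b i, y⟫_ℂ‖) ∧
      ∑' i, ‖⟪x, b i⟫_ℂ * ⟪b i, y⟫_ℂ‖ ≤ ‖x‖ * ‖y‖ := by
  have hx := b.orthonormal.inner_products_summable x
  have hy := b.orthonormal.inner_products_summable y
  have key := Real.summable_and_inner_le_Lp_mul_Lq_tsum_of_nonneg
    (f := fun i => ‖⟪b i, x⟫_ℂ‖) (g := fun i => ‖⟪b i, y⟫_ℂ‖)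
    Real.HolderConjugate.two_two (fun _ => norm_nonneg _) (fun _ => norm_nonneg _)
    (by simpa using hx) (by simpa using hy)
  have e : (fun i => ‖⟪x, b i⟫_ℂ * ⟪b i, y⟫_ℂ‖) = fun i => ‖⟪b i, x⟫_ℂ‖ * ‖⟪b i, y⟫_ℂ‖ := by
    ext i
    rw [norm_mul, norm_inner_symm]
  rw [e]
  refine ⟨key.1, key.2.trans ?_⟩
  simp only [Real.rpow_two, ← Real.sqrt_eq_rpow]
  have hx' := Real.sqrt_le_sqrt (b.orthonormal.tsum_inner_products_le x)
  have hy' := Real.sqrt_le_sqrt (b.orthonormal.tsum_inner_products_le y)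
  rw [Real.sqrt_sq (norm_nonneg _)] at hx' hy'
  gcongr

theorem HasTrace.unique {ι : Type} (b : HilbertBasis ι ℂ E) {T : E →L[ℂ] E} {τ τ' : ℂ}
    (h : HasTrace T τ) (h' : HasTrace T τ') : τ = τ' :=
  (h ι b).unique (h' ι b)

/-- A closed operator commutes with convergent sums. -/
theorem LinearPMap.IsClosed.hasSum {R : E →ₗ.[ℂ] E} (hR : R.IsClosed) {f g : κ → E} {x y : E}
    (hfg : ∀ k, (f k, g k) ∈ R.graph) (hf : HasSum f x) (hg : HasSum g y) :
    ∃ h : x ∈ R.domain, y = R ⟨x, h⟩ := by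
  have hmem : (x, y) ∈ R.graph := by
    have ht : HasSum (fun k => (f k, g k)) (x, y) := hf.prodMk hg
    exact _root_.IsClosed.mem_of_tendsto hR ht
      (Filter.Eventually.of_forall fun s => Submodule.sum_mem _ fun k _ => hfg k)
  refine ⟨R.mem_domain_of_mem_graph hmem, ?_⟩
  obtain ⟨z, hz, hz'⟩ := (LinearPMap.mem_graph_iff _).mp hmem
  subst hz
  exact hz'.symm

/-- In the spectral representation an eigenvector lives where `f = e`, so `φ ∘ f` acts on it as `φ
e`. This fixes the operator chosen in `expNeg` on a basis of eigenvectors, so general uniqueness of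
the functional calculus is not needed. -/
theorem IsFunctionOf.apply_eigenvector {φ : ℝ → ℝ} {A : E →ₗ.[ℂ] E} {G : E →L[ℂ] E}
    (hG : IsFunctionOf φ A G) {e : ℝ} (ψ : A.domain) (hψ : A ψ = (e : ℂ) • (ψ : E)) :
    G ψ = (φ e : ℂ) • (ψ : E) := by
  obtain ⟨α, _, μ, f, U, -, -, hA, hφ⟩ := hG
  apply U.injective
  rw [map_smul]
  apply Lp.ext
  have h1 := hA ψ
  rw [hψ, map_smul] at h1
  filter_upwards [h1, hφ ψ, Lp.coeFn_smul (e : ℂ) (U (ψ : E)),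
    Lp.coeFn_smul (φ e : ℂ) (U (ψ : E))] with a h1 h2 h3 h4
  rw [h2, h4]
  rw [h3] at h1
  simp only [Pi.smul_apply, smul_eq_mul] at h1 ⊢
  rcases eq_or_ne (U (ψ : E) a) 0 with h0 | h0
  · rw [h0, mul_zero, mul_zero]
  · rw [Complex.ofReal_injective (mul_right_cancel₀ h0 h1)]

theorem trace_eq {ι : Type} (b : HilbertBasis ι ℂ E) {T : E →L[ℂ] E} {τ : ℂ}
    (h : HasTrace T τ) : trace T = τ := by
  have hex : ∃ τ, HasTrace T τ := ⟨τ, h⟩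
  rw [trace, dif_pos hex]
  exact hex.choose_spec.unique b h

theorem HilbertBasis.clm_ext (b : HilbertBasis κ ℂ E) {S T : E →L[ℂ] E}
    (h : ∀ k, S (b k) = T (b k)) : S = T := by
  refine ContinuousLinearMap.ext_on (s := Set.range b) ?_ ?_
  · exact Submodule.dense_iff_topologicalClosure_eq_top.mpr b.dense_span
  · rintro _ ⟨k, rfl⟩
    exact h k

section Count

variable [MeasurableSpace κ] [MeasurableSingletonClass κ]

/-- The unit vectors of `L²` of the counting measure. -/
def countUnit (k : κ) : Lp ℂ 2 (Measure.count : Measure κ) :=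
  indicatorConstLp 2 (measurableSet_singleton k) (by simp) (1 : ℂ)

theorem inner_countUnit (k : κ) (f : Lp ℂ 2 (Measure.count : Measure κ)) :
    ⟪countUnit k, f⟫_ℂ = f k := by
  rw [countUnit, L2.inner_indicatorConstLp_one, integral_singleton]
  simp

theorem countUnit_apply [DecidableEq κ] (k j : κ) :
    countUnit k j = if j = k then 1 else 0 := by
  have h := Measure.ae_count_iff.mp
    (indicatorConstLp_coeFn (p := 2) (hs := measurableSet_singleton k)
      (hμs := (by simp : (Measure.count : Measure κ) {k} ≠ ⊤)) (c := (1 : ℂ))) j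
  rw [countUnit, h]
  simp [Set.indicator_apply]

/-- The unit vectors form a Hilbert basis of `L²` of the counting measure. -/
def countBasis : HilbertBasis κ ℂ (Lp ℂ 2 (Measure.count : Measure κ)) :=
  HilbertBasis.mkOfOrthogonalEqBot (v := countUnit)
    (by
      classical
      rw [orthonormal_iff_ite]
      intro i j
      rw [inner_countUnit, countUnit_apply])
    (by
      rw [Submodule.eq_bot_iff]
      intro f hf
      apply Lp.ext
      refine Measure.ae_count_iff.mpr fun k => ?_
      rw [Measure.ae_count_iff.mp (Lp.coeFn_zero ℂ 2 (Measure.count : Measure κ)) k,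
        ← inner_countUnit]
      exact hf _ (Submodule.subset_span ⟨k, rfl⟩))

theorem countBasis_repr_symm_apply (x : lp (fun _ : κ => ℂ) 2) (k : κ) :
    countBasis.repr.symm x k = x k := by
  rw [← inner_countUnit]
  have : (countBasis k : Lp ℂ 2 (Measure.count : Measure κ)) = countUnit k := by
    rw [countBasis, HilbertBasis.coe_mkOfOrthogonalEqBot]
  rw [← this, ← HilbertBasis.repr_apply_apply, LinearIsometryEquiv.apply_symm_apply]

end Count

/-- An operator with a complete orthonormal system of eigenvectors is carried to a multiplication
operator in the corresponding `L²` of the counting measure. -/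
theorem isFunctionOf_of_diagonal (b : HilbertBasis κ ℂ E) {e : κ → ℝ} {A : E →ₗ.[ℂ] E}
    (hdom : ∀ ψ : E, ψ ∈ A.domain ↔ Summable fun k => ‖(e k : ℂ) * ⟪b k, ψ⟫_ℂ‖ ^ 2)
    (hA : ∀ (ψ : A.domain) (k : κ), ⟪b k, A ψ⟫_ℂ = e k * ⟪b k, (ψ : E)⟫_ℂ)
    {φ : ℝ → ℝ} {G : E →L[ℂ] E} (hG : ∀ (ψ : E) (k : κ), ⟪b k, G ψ⟫_ℂ = φ (e k) * ⟪b k, ψ⟫_ℂ) :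
    IsFunctionOf φ A G := by
  -- For the discrete σ-algebra every function on `κ` is measurable, and almost everywhere for the
  -- counting measure means everywhere.
  let _ : MeasurableSpace κ := ⊤
  have : MeasurableSingletonClass κ := ⟨fun _ => trivial⟩
  set U : E ≃ₗᵢ[ℂ] Lp ℂ 2 (Measure.count : Measure κ) := b.repr.trans countBasis.repr.symm
  have hU (ψ : E) (k : κ) : U ψ k = ⟪b k, ψ⟫_ℂ := by
    rw [LinearIsometryEquiv.trans_apply, countBasis_repr_symm_apply, HilbertBasis.repr_apply_apply]
  refine ⟨κ, ⊤, Measure.count, e, U, measurable_from_top, fun ψ => ?_, fun ψ => ?_, fun ψ => ?_⟩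
  · rw [hdom, memLp_two_iff_integrable_sq_norm, integrable_count_iff]
    · simp only [hU, Real.norm_eq_abs, abs_of_nonneg (sq_nonneg (‖_‖ : ℝ))]
    · exact (measurable_from_top (f := fun k => (e k : ℂ) * U ψ k)).aestronglyMeasurable
  · exact Measure.ae_count_iff.mpr fun k => by
      simp only [hU, hA]
  · exact Measure.ae_count_iff.mpr fun k => by
      simp only [hU, hG]

variable [CompleteSpace E]

/-- The nuclear operator `∑ₖ ⟨uₖ, ·⟩ vₖ`. -/
def rankOneSum (u v : κ → E) : E →L[ℂ] E :=
  ∑' k, (innerSL ℂ (u k)).smulRight (v k)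

theorem summable_rankOne {u v : κ → E} (h : Summable fun k => ‖u k‖ * ‖v k‖) :
    Summable fun k => (innerSL ℂ (u k)).smulRight (v k) := by
  refine Summable.of_norm ?_
  simpa only [ContinuousLinearMap.norm_smulRight_apply, innerSL_apply_norm] using h

theorem hasSum_rankOneSum_apply {u v : κ → E} (h : Summable fun k => ‖u k‖ * ‖v k‖) (ψ : E) :
    HasSum (fun k => ⟪u k, ψ⟫_ℂ • v k) (rankOneSum u v ψ) :=
  (summable_rankOne h).hasSum.mapL (ContinuousLinearMap.apply ℂ E ψ)

/-- Parseval expands each `⟪u k, v k⟫` in the basis `b`. The double sum converges absolutely,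
because Cauchy–Schwarz and Bessel bound the inner sums by `‖u k‖ * ‖v k‖` for any basis, so it may
be summed in the other order. -/
theorem hasTrace_rankOneSum {u v : κ → E} (h : Summable fun k => ‖u k‖ * ‖v k‖) :
    HasTrace (rankOneSum u v) (∑' k, ⟪u k, v k⟫_ℂ) := by
  intro ι b
  have hs : Summable fun p : κ × ι => ⟪u p.1, b p.2⟫_ℂ * ⟪b p.2, v p.1⟫_ℂ := by
    refine Summable.of_norm ?_
    rw [summable_prod_of_nonneg fun _ => norm_nonneg _]
    refine ⟨fun k => (summable_norm_inner_mul_inner b (u k) (v k)).1, ?_⟩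
    exact h.of_nonneg_of_le (fun k => tsum_nonneg fun _ => norm_nonneg _)
      fun k => (summable_norm_inner_mul_inner b (u k) (v k)).2
  have h1 : ∑' k, ⟪u k, v k⟫_ℂ = ∑' p : κ × ι, ⟪u p.1, b p.2⟫_ℂ * ⟪b p.2, v p.1⟫_ℂ := by
    rw [hs.tsum_prod]
    exact tsum_congr fun k => (b.hasSum_inner_mul_inner (u k) (v k)).tsum_eq.symm
  rw [h1, ← (Equiv.prodComm ι κ).tsum_eq]
  have hs' := (Equiv.prodComm ι κ).summable_iff.mpr hs
  refine hs'.hasSum.prod_fiberwise fun i => ?_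
  have := (hasSum_rankOneSum_apply h (b i)).mapL (innerSL ℂ (b i))
  simp only [innerSL_apply_apply, inner_smul_right] at this
  exact this

theorem rankOneSum_basis (b : HilbertBasis κ ℂ E) {v : κ → E} (h : Summable fun k => ‖v k‖)
    (k : κ) : rankOneSum b v (b k) = v k := by
  classical
  have h' : Summable fun k => ‖b k‖ * ‖v k‖ := by
    simpa [b.orthonormal.norm_eq_one] using h
  refine (hasSum_rankOneSum_apply h' (b k)).unique ?_
  convert hasSum_ite_eq k (v k) using 2 with j
  rw [orthonormal_iff_ite.mp b.orthonormal j k]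
  split_ifs with hj
  · rw [hj, one_smul]
  · rw [zero_smul]

theorem eq_rankOneSum (b : HilbertBasis κ ℂ E) {T : E →L[ℂ] E}
    (h : Summable fun k => ‖T (b k)‖) : T = rankOneSum b fun k => T (b k) :=
  HilbertBasis.clm_ext b fun k => (rankOneSum_basis b h k).symm

theorem hasTrace_of_summable (b : HilbertBasis κ ℂ E) {T : E →L[ℂ] E}
    (h : Summable fun k => ‖T (b k)‖) : HasTrace T (∑' k, ⟪b k, T (b k)⟫_ℂ) := by
  have := hasTrace_rankOneSum (u := b) (v := fun k => T (b k))
    (by simpa [b.orthonormal.norm_eq_one] using h)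
  rwa [← eq_rankOneSum b h] at this

/-- The partial sums of the expansion of `G ψ` lie in the domain of `R`, and their images converge
because `|c k| * ‖v k‖` is summable; closedness of `R` then puts `G ψ` itself in the domain. -/
theorem exists_mul_of_diagonal (b : HilbertBasis κ ℂ E) {R : E →ₗ.[ℂ] E} (hR : R.IsClosed)
    {G : E →L[ℂ] E} {c : κ → ℝ} {v : κ → E} (hG : ∀ k, G (b k) = (c k : ℂ) • b k)
    (hc : Summable fun k => |c k|) (hv : ∀ k, (b k, v k) ∈ R.graph)
    (hcv : Summable fun k => |c k| * ‖v k‖) :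
    ∃ T : E →L[ℂ] E, (∀ ψ : E, ∃ h : G ψ ∈ R.domain, T ψ = R ⟨G ψ, h⟩) ∧
      ∀ k, T (b k) = (c k : ℂ) • v k := by
  have hc' : Summable fun k => ‖(c k : ℂ) • b k‖ := by
    simpa [norm_smul, b.orthonormal.norm_eq_one] using hc
  have hcv' : Summable fun k => ‖(c k : ℂ) • v k‖ := by
    simpa [norm_smul] using hcv
  refine ⟨rankOneSum b fun k => (c k : ℂ) • v k, fun ψ => ?_, rankOneSum_basis b hcv'⟩
  have hGe : G = rankOneSum b fun k => (c k : ℂ) • b k :=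
    HilbertBasis.clm_ext b fun k => by rw [rankOneSum_basis b hc', hG]
  have h1 : HasSum (fun k => ⟪b k, ψ⟫_ℂ • (c k : ℂ) • b k) (G ψ) := by
    rw [hGe]
    exact hasSum_rankOneSum_apply (by simpa [b.orthonormal.norm_eq_one] using hc') ψ
  have h2 : HasSum (fun k => ⟪b k, ψ⟫_ℂ • (c k : ℂ) • v k)
      (rankOneSum b (fun k => (c k : ℂ) • v k) ψ) :=
    hasSum_rankOneSum_apply (by simpa [b.orthonormal.norm_eq_one] using hcv') ψ
  exact LinearPMap.IsClosed.hasSum hR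
    (fun k => R.graph.smul_mem _ (R.graph.smul_mem _ (hv k))) h1 h2

theorem hasTraceMul_of_diagonal (b : HilbertBasis κ ℂ E) {R : E →ₗ.[ℂ] E} (hR : R.IsClosed)
    {G : E →L[ℂ] E} {c : κ → ℝ} {v : κ → E} (hG : ∀ k, G (b k) = (c k : ℂ) • b k)
    (hc : Summable fun k => |c k|) (hv : ∀ k, (b k, v k) ∈ R.graph)
    (hcv : Summable fun k => |c k| * ‖v k‖) {τ : ℂ}
    (hτ : HasSum (fun k => (c k : ℂ) * ⟪b k, v k⟫_ℂ) τ) : HasTraceMul R G τ := by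
  obtain ⟨T, hT, hTb⟩ := exists_mul_of_diagonal b hR hG hc hv hcv
  refine ⟨T, hT, ?_⟩
  have := hasTrace_of_summable b (T := T) (by simpa [hTb, norm_smul] using hcv)
  simpa only [hTb, inner_smul_right, hτ.tsum_eq] using this

/-- The diagonal operator with entries `√(c k)` is positive and squares to `G`; positive square
roots are unique. -/
theorem sqrt_of_diagonal (b : HilbertBasis κ ℂ E) {G : E →L[ℂ] E} {c : κ → ℝ}
    (hc0 : ∀ k, 0 ≤ c k) (hG : ∀ k, G (b k) = (c k : ℂ) • b k)
    (hc : Summable fun k => √(c k)) (k : κ) :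
    CFC.sqrt G (b k) = (√(c k) : ℂ) • b k := by
  have hc' : Summable fun k => ‖(√(c k) : ℂ) • b k‖ := by
    simpa [norm_smul, b.orthonormal.norm_eq_one, abs_of_nonneg (Real.sqrt_nonneg _)] using hc
  set Q : E →L[ℂ] E := rankOneSum b fun k => (√(c k) : ℂ) • b k with hQ
  have hQb : ∀ k, Q (b k) = (√(c k) : ℂ) • b k := rankOneSum_basis b hc'
  have hQsum (ψ : E) : HasSum (fun k => ⟪b k, ψ⟫_ℂ • (√(c k) : ℂ) • b k) (Q ψ) :=
    hasSum_rankOneSum_apply (by simpa [b.orthonormal.norm_eq_one] using hc') ψ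
  have hQQ : Q * Q = G := HilbertBasis.clm_ext b fun k => by
    rw [mul_apply_eq_comp, hQb, map_smul, hQb, smul_smul, hG, ← Complex.ofReal_mul,
      Real.mul_self_sqrt (hc0 k)]
  have hQ0 : 0 ≤ Q := by
    rw [ContinuousLinearMap.nonneg_iff_isPositive, ContinuousLinearMap.isPositive_def]
    constructor
    · intro ψ η
      have h1 := (hQsum η).mapL (innerSL ℂ ψ)
      have h2 := ((hQsum ψ).mapL (innerSL ℂ η)).star
      simp only [innerSL_apply_apply] at h1 h2
      rw [RCLike.star_def, inner_conj_symm] at h2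
      refine h2.unique ((congrArg (HasSum · _) (funext fun k => ?_)).mp h1)
      simp only [inner_smul_right, map_mul, inner_conj_symm, Complex.conj_ofReal]
      ring
    · intro ψ
      have h1 := ((hQsum ψ).mapL (innerSL ℂ ψ)).mapL Complex.reCLM
      rw [ContinuousLinearMap.reApplyInnerSelf_apply, inner_re_symm]
      refine h1.nonneg fun k => ?_
      simp only [innerSL_apply_apply, inner_smul_right, Complex.reCLM_apply]
      rw [← inner_conj_symm ψ (b k), mul_left_comm, Complex.mul_conj, ← Complex.ofReal_mul,
        Complex.ofReal_re]
      exact mul_nonneg (Real.sqrt_nonneg _) (Complex.normSq_nonneg _)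
  rw [CFC.sqrt_unique hQQ hQ0, hQb]

/-- The diagonal entries of `S* S` are `‖S (b k)‖² = c k * ‖v k‖²`. Here `S` itself is nuclear, more
than the Hilbert–Schmidt property that a trace class `S* S` requires; the geometric decay of the
thermal weights provides this. -/
theorem hasSymmTraceMul_of_diagonal (b : HilbertBasis κ ℂ E) {R : E →ₗ.[ℂ] E} (hR : R.IsClosed)
    {G : E →L[ℂ] E} {c : κ → ℝ} {v : κ → E} (hc0 : ∀ k, 0 ≤ c k)
    (hG : ∀ k, G (b k) = (c k : ℂ) • b k)
    (hc : Summable fun k => √(c k)) (hv : ∀ k, (b k, v k) ∈ R.graph)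
    (hcv : Summable fun k => √(c k) * ‖v k‖) {τ : ℝ}
    (hτ : HasSum (fun k => c k * ‖v k‖ ^ 2) τ) : HasSymmTraceMul R G τ := by
  have habs (k : κ) : |√(c k)| = √(c k) := abs_of_nonneg (Real.sqrt_nonneg _)
  obtain ⟨S, hS, hSb⟩ := exists_mul_of_diagonal b hR (sqrt_of_diagonal b hc0 hG hc)
    (by simpa only [habs] using hc) hv (by simpa only [habs] using hcv)
  refine ⟨S, hS, ?_⟩
  have hnorm (k : κ) : ‖S (b k)‖ = √(c k) * ‖v k‖ := by
    rw [hSb, norm_smul, Complex.norm_real, Real.norm_eq_abs, habs]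
  have := hasTrace_of_summable b (T := ContinuousLinearMap.adjoint S ∘L S) (by
    refine (hcv.mul_left ‖ContinuousLinearMap.adjoint S‖).of_nonneg_of_le
      (fun _ => norm_nonneg _) fun k => ?_
    rw [← hnorm]
    exact (ContinuousLinearMap.adjoint S).le_opNorm _)
  have he (k : κ) : ⟪b k, (ContinuousLinearMap.adjoint S ∘L S) (b k)⟫_ℂ
      = ((c k * ‖v k‖ ^ 2 : ℝ) : ℂ) := by
    rw [ContinuousLinearMap.comp_apply, ContinuousLinearMap.adjoint_inner_right,
      inner_self_eq_norm_sq_to_K, hnorm]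
    norm_cast
    rw [mul_pow, Real.sq_sqrt (hc0 k)]
    rfl
  simp only [he] at this
  rwa [← Complex.ofReal_tsum, hτ.tsum_eq] at this

end Hilbert


/-! ### Position, derivatives and Gaussians on Schwartz functions. -/

section Schwartz

open scoped ContDiff

variable {d : ℕ}

/-- The `j`-th partial derivative on Schwartz functions. -/
def partialDeriv (d : ℕ) (j : Fin d) : 𝓢(Space d, ℂ) →L[ℂ] 𝓢(Space d, ℂ) :=
  LineDeriv.lineDerivOpCLM ℂ 𝓢(Space d, ℂ) (EuclideanSpace.single j (1 : ℝ))

theorem partialDeriv_apply (j : Fin d) (φ : 𝓢(Space d, ℂ)) (x : Space d) :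
    partialDeriv d j φ x = fderiv ℝ φ x (EuclideanSpace.single j 1) := rfl

theorem momentum_eq (ħ : ℝ) (j : Fin d) :
    momentum d ħ j = (-Complex.I * (ħ : ℂ)) • partialDeriv d j := rfl

theorem hasTemperateGrowth_coord (j : Fin d) :
    Function.HasTemperateGrowth fun x : Space d => ((x j : ℝ) : ℂ) :=
  (Complex.ofRealCLM.comp (EuclideanSpace.proj (𝕜 := ℝ) j)).hasTemperateGrowth

theorem position_apply (j : Fin d) (φ : 𝓢(Space d, ℂ)) (x : Space d) :
    position d j φ x = (x j : ℂ) * φ x := by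
  rw [position, smulLeftCLM_apply_apply (hasTemperateGrowth_coord j), smul_eq_mul]

theorem partialDeriv_smulLeftCLM {g : Space d → ℂ} (hg : g.HasTemperateGrowth) (j : Fin d)
    (φ : 𝓢(Space d, ℂ)) (x : Space d) :
    partialDeriv d j (smulLeftCLM ℂ g φ) x =
      fderiv ℝ g x (EuclideanSpace.single j 1) * φ x + g x * partialDeriv d j φ x := by
  have h1 : (smulLeftCLM ℂ g φ : Space d → ℂ) = fun y => g y * φ y := by
    ext y
    rw [smulLeftCLM_apply_apply hg, smul_eq_mul]
  rw [partialDeriv_apply, partialDeriv_apply, h1,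
    fderiv_fun_mul (hg.1.differentiable (by simp) x) (φ.differentiable x)]
  simp only [add_apply, smul_apply, smul_eq_mul]
  ring

/-- The canonical commutation relation `[∂_i, x_j] = δ_ij`, from which all the ladder algebra
follows. -/
theorem partialDeriv_position (i j : Fin d) (φ : 𝓢(Space d, ℂ)) :
    partialDeriv d i (position d j φ) =
      (if i = j then φ else 0) + position d j (partialDeriv d i φ) := by
  ext x
  have hf : fderiv ℝ (fun x : Space d => ((x j : ℝ) : ℂ)) x =
      Complex.ofRealCLM.comp (EuclideanSpace.proj (𝕜 := ℝ) j) :=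
    (Complex.ofRealCLM.comp (EuclideanSpace.proj (𝕜 := ℝ) j)).fderiv
  rw [position, partialDeriv_smulLeftCLM (hasTemperateGrowth_coord j), hf, ← position, add_apply,
    position_apply]
  by_cases h : i = j
  · subst h
    simp
  · simp [h, Ne.symm h]

theorem partialDeriv_comm (i j : Fin d) (φ : 𝓢(Space d, ℂ)) :
    partialDeriv d i (partialDeriv d j φ) = partialDeriv d j (partialDeriv d i φ) := by
  ext x
  have h2 : ContDiffAt ℝ 2 φ x := (φ.smooth 2).contDiffAt
  have hsymm : IsSymmSndFDerivAt ℝ φ x := h2.isSymmSndFDerivAt (by simp)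
  have hd : DifferentiableAt ℝ (fderiv ℝ φ) x :=
    ((φ.smooth 2).fderiv_right (m := 1) (by norm_num)).differentiable (by simp) x
  have key (i j : Fin d) : partialDeriv d i (partialDeriv d j φ) x =
      fderiv ℝ (fderiv ℝ φ) x (EuclideanSpace.single i 1) (EuclideanSpace.single j 1) := by
    rw [partialDeriv_apply]
    have : (partialDeriv d j φ : Space d → ℂ) =
        fun y => fderiv ℝ φ y (EuclideanSpace.single j 1) := rfl
    rw [this, fderiv_clm_apply hd (differentiableAt_const _)]
    simp
  rw [key, key, hsymm.eq]

theorem position_comm (i j : Fin d) (φ : 𝓢(Space d, ℂ)) :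
    position d i (position d j φ) = position d j (position d i φ) := by
  ext x
  simp only [position_apply]
  ring

theorem inner_schwartzIncl (φ ψ : 𝓢(Space d, ℂ)) :
    ⟪schwartzIncl d φ, schwartzIncl d ψ⟫_ℂ = ∫ x, (starRingEnd ℂ) (φ x) * ψ x := by
  have := inner_toL2_toL2_eq φ ψ (volume : Measure (Space d))
  simp only [RCLike.inner_apply'] at this
  exact this

theorem inner_position (j : Fin d) (φ ψ : 𝓢(Space d, ℂ)) :
    ⟪schwartzIncl d φ, schwartzIncl d (position d j ψ)⟫_ℂ =
      ⟪schwartzIncl d (position d j φ), schwartzIncl d ψ⟫_ℂ := by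
  rw [inner_schwartzIncl, inner_schwartzIncl]
  refine integral_congr_ae (Filter.Eventually.of_forall fun x => ?_)
  simp only [position_apply, map_mul, Complex.conj_ofReal]
  ring

theorem inner_partialDeriv (j : Fin d) (φ ψ : 𝓢(Space d, ℂ)) :
    ⟪schwartzIncl d φ, schwartzIncl d (partialDeriv d j ψ)⟫_ℂ =
      -⟪schwartzIncl d (partialDeriv d j φ), schwartzIncl d ψ⟫_ℂ := by
  rw [inner_schwartzIncl, inner_schwartzIncl]
  exact integral_bilinear_lineDerivOp_right_eq_neg_left φ ψ
    ((ContinuousLinearMap.mul ℝ ℂ).comp Complex.conjCLE.toContinuousLinearMap)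
    (EuclideanSpace.single j 1)

/-- The power is at most `p! exp (1 + r)`, and completing the square gives `r - a r² ≤ 1 / (4 a)`.
An explicit constant of this kind yields the Schwartz decay of Gaussians. -/
theorem one_add_pow_mul_exp_neg_sq_le {a : ℝ} (ha : 0 < a) (p : ℕ) {r : ℝ} (hr : 0 ≤ r) :
    (1 + r) ^ p * Real.exp (-(a * r ^ 2)) ≤ p.factorial * Real.exp (1 + 1 / (4 * a)) := by
  have h1 : (1 + r) ^ p ≤ p.factorial * Real.exp (1 + r) := by
    have := Real.pow_div_factorial_le_exp (1 + r) (by positivity) p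
    rwa [div_le_iff₀' (by positivity)] at this
  calc (1 + r) ^ p * Real.exp (-(a * r ^ 2))
      ≤ (p.factorial * Real.exp (1 + r)) * Real.exp (-(a * r ^ 2)) := by gcongr
    _ = p.factorial * Real.exp (1 + r - a * r ^ 2) := by
      rw [mul_assoc, ← Real.exp_add, sub_eq_add_neg]
    _ ≤ _ := by
      gcongr
      have : 1 / (4 * a) - (r - a * r ^ 2) = a * (r - 1 / (2 * a)) ^ 2 := by
        field_simp
        ring
      nlinarith [mul_nonneg ha.le (sq_nonneg (r - 1 / (2 * a)))]

theorem norm_iteratedFDeriv_exp_neg (n : ℕ) (t : ℝ) :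
    ‖iteratedFDeriv ℝ n (fun t : ℝ => Real.exp (-t)) t‖ = Real.exp (-t) := by
  rw [norm_iteratedFDeriv_eq_norm_iteratedDeriv, iteratedDeriv_comp_neg, iteratedDeriv_eq_iterate,
    Real.iter_deriv_exp]
  simp

/-- The Gaussian `exp (-a |x|²)` as a real Schwartz function. -/
def realGaussian (d : ℕ) {a : ℝ} (ha : 0 < a) : 𝓢(Space d, ℝ) where
  toFun x := Real.exp (-(a * ‖x‖ ^ 2))
  smooth' := (contDiff_const.mul (contDiff_norm_sq ℝ)).neg.exp
  decay' k n := by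
    have hq : Function.HasTemperateGrowth fun x : Space d => a * ‖x‖ ^ 2 :=
      (Function.HasTemperateGrowth.const a).mul (Function.hasTemperateGrowth_norm_sq (Space d))
    obtain ⟨m, C, hC, hD⟩ := hq.norm_iteratedFDeriv_le_uniform n
    refine ⟨n.factorial * (1 + C) ^ n *
      ((k + m * n).factorial * Real.exp (1 + 1 / (4 * a))), fun x => ?_⟩
    -- Faà di Bruno's bound needs the `i`-th derivative of the exponent to be at most `D ^ i`.
    -- Taking `1 + C` in place of `C` makes `D ≥ 1`, so a bound by `D` itself is enough for `i ≥ 1`.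
    have h := norm_iteratedFDeriv_comp_le (g := fun t : ℝ => Real.exp (-t))
      (f := fun x : Space d => a * ‖x‖ ^ 2) (n := n) (N := ∞) (by fun_prop)
      (contDiff_const.mul (contDiff_norm_sq ℝ))
      (mod_cast le_top) x (C := Real.exp (-(a * ‖x‖ ^ 2))) (D := (1 + C) * (1 + ‖x‖) ^ m)
      (fun i _ => (norm_iteratedFDeriv_exp_neg i _).le)
      (fun i hi hin => by
        have h1 : 1 ≤ (1 + C) * (1 + ‖x‖) ^ m :=
          one_le_mul_of_one_le_of_one_le (by linarith)
            (one_le_pow₀ (by linarith [norm_nonneg x]))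
        refine ((hD i hin x).trans ?_).trans (le_self_pow₀ h1 (by omega))
        gcongr
        linarith)
    calc ‖x‖ ^ k * ‖iteratedFDeriv ℝ n (fun x : Space d => Real.exp (-(a * ‖x‖ ^ 2))) x‖
        ≤ (1 + ‖x‖) ^ k * (n.factorial * Real.exp (-(a * ‖x‖ ^ 2)) *
            ((1 + C) * (1 + ‖x‖) ^ m) ^ n) := by
          gcongr
          · linarith
          · exact h
      _ = n.factorial * (1 + C) ^ n *
            ((1 + ‖x‖) ^ (k + m * n) * Real.exp (-(a * ‖x‖ ^ 2))) := by
          rw [mul_pow, ← pow_mul, pow_add]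
          ring
      _ ≤ _ := by
          exact mul_le_mul_of_nonneg_left
            (one_add_pow_mul_exp_neg_sq_le ha _ (norm_nonneg x)) (by positivity)

/-- The Gaussian `exp (-a |x|²)` as a complex Schwartz function. -/
def gaussian (d : ℕ) {a : ℝ} (ha : 0 < a) : 𝓢(Space d, ℂ) :=
  (realGaussian d ha).postcompCLM Complex.ofRealCLM

theorem gaussian_apply {a : ℝ} (ha : 0 < a) (x : Space d) :
    gaussian d ha x = (Real.exp (-(a * ‖x‖ ^ 2)) : ℝ) := rfl

theorem partialDeriv_gaussian {a : ℝ} (ha : 0 < a) (j : Fin d) :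
    partialDeriv d j (gaussian d ha) = (-(2 * a) : ℂ) • position d j (gaussian d ha) := by
  ext x
  have h1 : HasFDerivAt (fun x : Space d => Real.exp (-(a * ‖x‖ ^ 2))) _ x :=
    (((hasStrictFDerivAt_norm_sq x).hasFDerivAt.const_mul a).neg).exp
  have h2 : HasFDerivAt (gaussian d ha) _ x := Complex.ofRealCLM.hasFDerivAt.comp x h1
  rw [partialDeriv_apply, h2.fderiv, smul_apply, position_apply, gaussian_apply]
  simp [EuclideanSpace.inner_single_right]
  ring

end Schwartz


/-! ### Ladder operators and Hermite functions. -/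

section Ladder

variable {d : ℕ}

/-- The lowering operator `s x_j + t ∂_j`. -/
def lowering (s t : ℝ) (j : Fin d) : Module.End ℂ 𝓢(Space d, ℂ) :=
  (s : ℂ) • (position d j).toLinearMap + (t : ℂ) • (partialDeriv d j).toLinearMap

/-- The raising operator `s x_j - t ∂_j`. -/
def raising (s t : ℝ) (j : Fin d) : Module.End ℂ 𝓢(Space d, ℂ) :=
  (s : ℂ) • (position d j).toLinearMap - (t : ℂ) • (partialDeriv d j).toLinearMap

theorem lowering_apply (s t : ℝ) (j : Fin d) (φ : 𝓢(Space d, ℂ)) :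
    lowering s t j φ = (s : ℂ) • position d j φ + (t : ℂ) • partialDeriv d j φ := rfl

theorem raising_apply (s t : ℝ) (j : Fin d) (φ : 𝓢(Space d, ℂ)) :
    raising s t j φ = (s : ℂ) • position d j φ - (t : ℂ) • partialDeriv d j φ := rfl

theorem lowering_add_raising (s t : ℝ) (j : Fin d) (φ : 𝓢(Space d, ℂ)) :
    lowering s t j φ + raising s t j φ = (2 * s : ℂ) • position d j φ := by
  rw [lowering_apply, raising_apply]
  module

theorem inner_raising (s t : ℝ) (j : Fin d) (φ ψ : 𝓢(Space d, ℂ)) :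
    ⟪schwartzIncl d φ, schwartzIncl d (raising s t j ψ)⟫_ℂ =
      ⟪schwartzIncl d (lowering s t j φ), schwartzIncl d ψ⟫_ℂ := by
  simp only [lowering_apply, raising_apply, map_add, map_sub, map_smul, inner_sub_right,
    inner_add_left, inner_smul_left, inner_smul_right, inner_position, inner_partialDeriv,
    Complex.conj_ofReal]
  ring

theorem inner_lowering (s t : ℝ) (j : Fin d) (φ ψ : 𝓢(Space d, ℂ)) :
    ⟪schwartzIncl d φ, schwartzIncl d (lowering s t j ψ)⟫_ℂ =
      ⟪schwartzIncl d (raising s t j φ), schwartzIncl d ψ⟫_ℂ := by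
  rw [← inner_conj_symm, ← inner_raising, inner_conj_symm]

/-- The commutator `[a_i, a_j†] = 2 s t δ_ij`; the normalization `2 s t = 1` used later makes it
canonical. -/
theorem lowering_raising (s t : ℝ) (i j : Fin d) (φ : 𝓢(Space d, ℂ)) :
    lowering s t i (raising s t j φ) =
      (if i = j then (2 * s * t : ℂ) else 0) • φ + raising s t j (lowering s t i φ) := by
  simp only [lowering_apply, raising_apply, map_add, map_sub, map_smul, partialDeriv_position,
    position_comm i j, partialDeriv_comm i j]
  by_cases h : i = j
  · subst h
    simp only [if_true]
    module
  · simp only [h, Ne.symm h, if_false]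
    module

theorem raising_comm (s t : ℝ) (i j : Fin d) :
    Commute (raising s t i) (raising s t j) := by
  ext1 φ
  simp only [Module.End.mul_apply, raising_apply, map_sub, map_smul, partialDeriv_position,
    position_comm i j, partialDeriv_comm i j]
  by_cases h : i = j
  · subst h
    rfl
  · simp only [h, Ne.symm h, if_false]
    module

/-- The raising operators commute, so their monomials can be formed by `MonoidHom.noncommPiCoprod`
with no ordering of the factors. -/
theorem commute_powersHom_raising (s t : ℝ) : Pairwise fun i j : Fin d =>
    ∀ x y : Multiplicative ℕ, Commute (powersHom _ (raising s t i) x)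
      (powersHom _ (raising s t j) y) := fun i j _ x y => by
  simpa only [powersHom_apply] using (raising_comm s t i j).pow_pow x.toAdd y.toAdd

/-- Products of powers of the raising operators. -/
def raisingMonomial (s t : ℝ) (k : Fin d → ℕ) : Module.End ℂ 𝓢(Space d, ℂ) :=
  MonoidHom.noncommPiCoprod (fun j => powersHom _ (raising s t j))
    (commute_powersHom_raising s t)
    (fun j => Multiplicative.ofAdd (k j))

theorem raisingMonomial_zero (s t : ℝ) : raisingMonomial s t (0 : Fin d → ℕ) = 1 :=
  map_one (MonoidHom.noncommPiCoprod _ _)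

theorem raisingMonomial_add_single (s t : ℝ) (k : Fin d → ℕ) (j : Fin d) :
    raisingMonomial s t (k + Pi.single j 1) = raising s t j * raisingMonomial s t k := by
  have h : (fun i => Multiplicative.ofAdd ((k + Pi.single j 1 : Fin d → ℕ) i)) =
      Pi.mulSingle (M := fun _ : Fin d => Multiplicative ℕ) j (Multiplicative.ofAdd 1) *
        fun i => Multiplicative.ofAdd (k i) := by
    ext i
    by_cases hij : i = j
    · subst hij
      simp [mul_comm]
    · simp [hij]
  rw [raisingMonomial, h, map_mul, MonoidHom.noncommPiCoprod_mulSingle, powersHom_apply]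
  simp [raisingMonomial]

theorem sub_single_add_single {k : Fin d → ℕ} {j : Fin d} (hj : k j ≠ 0) :
    k - Pi.single j 1 + Pi.single j 1 = k := by
  ext i
  by_cases hij : i = j
  · subst hij
    simp
    omega
  · simp [hij]

theorem add_single_sub_single (k : Fin d → ℕ) (j : Fin d) :
    k + Pi.single j 1 - Pi.single j 1 = k := by
  ext i
  simp

theorem multiIndex_induction {p : (Fin d → ℕ) → Prop} (zero : p 0)
    (add_single : ∀ k j, p k → p (k + Pi.single j 1)) (k : Fin d → ℕ) : p k := by
  induction hn : ∑ j, k j generalizing k with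
  | zero =>
    have : k = 0 := funext fun j => by simpa using (Finset.sum_eq_zero_iff.mp hn) j
    rwa [this]
  | succ n ih =>
    obtain ⟨j, -, hj⟩ : ∃ j ∈ Finset.univ, k j ≠ 0 :=
      Finset.exists_ne_zero_of_sum_ne_zero (by omega)
    have hk := sub_single_add_single hj
    rw [← hk]
    refine add_single _ j (ih _ ?_)
    rw [← hk] at hn
    simpa [Finset.sum_add_distrib] using hn

theorem prod_factorial_add_single (k : Fin d → ℕ) (i : Fin d) :
    (∏ j, ((k + Pi.single i 1 : Fin d → ℕ) j).factorial) =
      (k i + 1) * ∏ j, (k j).factorial := by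
    rw [← Finset.mul_prod_erase _ _ (Finset.mem_univ i),
      ← Finset.mul_prod_erase Finset.univ (fun j => (k j).factorial) (Finset.mem_univ i)]
    rw [← mul_assoc]
    congr 1
    · simp [Nat.factorial_succ]
    · refine Finset.prod_congr rfl fun j hj => ?_
      simp [Finset.ne_of_mem_erase hj]

/-- A family of normalized Schwartz functions on which `s x_j + t ∂_j` and `s x_j - t ∂_j` act as
the ladder operators of the harmonic oscillator, up to a phase. -/
structure IsLadder (s t : ℝ) (ω : ℂ) (u : (Fin d → ℕ) → 𝓢(Space d, ℂ)) : Prop where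
  norm_eq_one : ∀ k, ‖schwartzIncl d (u k)‖ = 1
  lowering_eq : ∀ j k, lowering s t j (u k) = (ω * √(k j)) • u (k - Pi.single j 1)
  raising_eq : ∀ j k, raising s t j (u k) =
    ((starRingEnd ℂ) ω * √(k j + 1)) • u (k + Pi.single j 1)

theorem IsLadder.raising_lowering {s t : ℝ} {ω : ℂ} {u : (Fin d → ℕ) → 𝓢(Space d, ℂ)}
    (h : IsLadder s t ω u) (j : Fin d) (k : Fin d → ℕ) :
    raising s t j (lowering s t j (u k)) = ((starRingEnd ℂ) ω * ω * k j) • u k := by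
  rw [h.lowering_eq, map_smul, h.raising_eq]
  -- When `k j = 0` the truncated `k - Pi.single j 1` is `k` itself, which is harmless because the
  -- coefficient `√(k j)` vanishes.
  rcases Nat.eq_zero_or_pos (k j) with hk | hk
  · simp [hk]
  · rw [sub_single_add_single hk.ne', smul_smul]
    congr 1
    have : (((k - Pi.single j 1 : Fin d → ℕ) j : ℕ) : ℝ) + 1 = k j := by
      rw [Pi.sub_apply, Pi.single_eq_same, Nat.cast_sub hk]
      simp
    rw [this, mul_mul_mul_comm, ← Complex.ofReal_mul, Real.mul_self_sqrt (Nat.cast_nonneg _)]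
    push_cast
    ring

theorem IsLadder.lowering_raising {s t : ℝ} {ω : ℂ} {u : (Fin d → ℕ) → 𝓢(Space d, ℂ)}
    (h : IsLadder s t ω u) (j : Fin d) (k : Fin d → ℕ) :
    lowering s t j (raising s t j (u k)) = ((starRingEnd ℂ) ω * ω * (k j + 1)) • u k := by
  rw [h.raising_eq, map_smul, h.lowering_eq, add_single_sub_single, smul_smul]
  congr 1
  have : (((k + Pi.single j 1 : Fin d → ℕ) j : ℕ) : ℝ) = k j + 1 := by simp
  rw [this, mul_mul_mul_comm, ← Complex.ofReal_mul, Real.mul_self_sqrt (by positivity)]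
  push_cast
  ring

/-- The number operators `a_j† a_j` are symmetric with eigenvalue `k j` on `u k`, and two distinct
multi-indices differ in some coordinate. -/
theorem IsLadder.orthonormal {s t : ℝ} {u : (Fin d → ℕ) → 𝓢(Space d, ℂ)}
    (h : IsLadder s t 1 u) : Orthonormal ℂ fun k => schwartzIncl d (u k) := by
  refine ⟨h.norm_eq_one, fun k l hkl => ?_⟩
  obtain ⟨j, hj⟩ := Function.ne_iff.mp hkl
  have h1 : ⟪schwartzIncl d (u k), schwartzIncl d (raising s t j (lowering s t j (u l)))⟫_ℂ =
      ⟪schwartzIncl d (raising s t j (lowering s t j (u k))), schwartzIncl d (u l)⟫_ℂ := by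
    rw [inner_raising, inner_lowering]
  rw [h.raising_lowering, h.raising_lowering, map_smul, map_smul, inner_smul_left,
    inner_smul_right] at h1
  simp only [map_one, one_mul, map_natCast] at h1
  have h2 : ((l j : ℂ) - k j) * ⟪schwartzIncl d (u k), schwartzIncl d (u l)⟫_ℂ = 0 := by
    rw [sub_mul, h1, sub_self]
  refine (mul_eq_zero.mp h2).resolve_left ?_
  refine sub_ne_zero.mpr ?_
  exact_mod_cast hj.symm

section Hermite

variable {s t : ℝ}

theorem lowering_gaussian (ht : 0 < t) (ha : 0 < s / (2 * t)) (j : Fin d) :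
    lowering s t j (gaussian d ha) = 0 := by
  rw [lowering_apply, partialDeriv_gaussian, smul_smul, ← add_smul]
  have : (s : ℂ) + t * -(2 * ((s / (2 * t) : ℝ) : ℂ)) = 0 := by
    have : (t : ℂ) ≠ 0 := by exact_mod_cast ht.ne'
    push_cast
    field_simp
    ring
  rw [this, zero_smul]

/-- The Gaussian is annihilated and `[a_i, a_j†] = δ_ij`, so `a_j` acts on monomials in the `a†` as
the derivative with respect to `a_j†`. -/
theorem lowering_raisingMonomial_gaussian (ht : 0 < t) (hst : 2 * s * t = 1)
    (ha : 0 < s / (2 * t)) (j : Fin d) (k : Fin d → ℕ) :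
    lowering s t j (raisingMonomial s t k (gaussian d ha)) =
      (k j : ℂ) • raisingMonomial s t (k - Pi.single j 1) (gaussian d ha) := by
  have hst' : (2 * s * t : ℂ) = 1 := by exact_mod_cast hst
  induction k using multiIndex_induction with
  | zero => simp [raisingMonomial_zero, lowering_gaussian ht ha]
  | add_single k i ih =>
    rw [raisingMonomial_add_single, Module.End.mul_apply, ThermalState.lowering_raising, ih, hst',
      map_smul]
    by_cases hij : j = i
    · subst hij
      rw [add_single_sub_single, if_pos rfl]
      rcases Nat.eq_zero_or_pos (k j) with hk | hk
      · simp [hk]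
      · rw [← Module.End.mul_apply, ← raisingMonomial_add_single, sub_single_add_single hk.ne',
          ← add_smul]
        simp [add_comm]
    · rw [if_neg hij, zero_smul, zero_add, ← Module.End.mul_apply, ← raisingMonomial_add_single]
      have h1 : (k + Pi.single i 1 : Fin d → ℕ) j = k j := by simp [hij]
      rw [h1]
      rcases Nat.eq_zero_or_pos (k j) with hk | hk
      · simp [hk]
      · congr 3
        ext l
        by_cases hl : l = j
        · subst hl
          simp [hij]
        · simp [hl]

theorem schwartzIncl_gaussian_ne_zero {a : ℝ} (ha : 0 < a) :
    schwartzIncl d (gaussian d ha) ≠ 0 := by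
  intro h
  have h0 := schwartzIncl_injective d (h.trans (map_zero (schwartzIncl d)).symm)
  have := congrArg (fun φ : 𝓢(Space d, ℂ) => φ 0) h0
  simp [gaussian_apply] at this

/-- Raising is adjoint to lowering, and lowering undoes one raising step with the factor `k i + 1`;
the factorials accumulate. -/
theorem norm_sq_raisingMonomial_gaussian (ht : 0 < t) (hst : 2 * s * t = 1)
    (ha : 0 < s / (2 * t)) (k : Fin d → ℕ) :
    ‖schwartzIncl d (raisingMonomial s t k (gaussian d ha))‖ ^ 2 =
      (∏ j, (k j).factorial : ℕ) * ‖schwartzIncl d (gaussian d ha)‖ ^ 2 := by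
  induction k using multiIndex_induction with
  | zero => simp [raisingMonomial_zero]
  | add_single k i ih =>
    have h1 : (‖schwartzIncl d (raisingMonomial s t (k + Pi.single i 1) (gaussian d ha))‖ ^ 2 : ℂ)
        = (k i + 1) * ‖schwartzIncl d (raisingMonomial s t k (gaussian d ha))‖ ^ 2 := by
      have e1 := inner_self_eq_norm_sq_to_K (𝕜 := ℂ)
        (schwartzIncl d (raisingMonomial s t (k + Pi.single i 1) (gaussian d ha)))
      have e2 := inner_self_eq_norm_sq_to_K (𝕜 := ℂ)
        (schwartzIncl d (raisingMonomial s t k (gaussian d ha)))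
      simp only [Complex.coe_algebraMap] at e1 e2
      rw [← e1, ← e2]
      nth_rw 2 [raisingMonomial_add_single]
      rw [Module.End.mul_apply, inner_raising, lowering_raisingMonomial_gaussian ht hst ha,
        add_single_sub_single, map_smul, inner_smul_left]
      simp
    have h2 : ‖schwartzIncl d (raisingMonomial s t (k + Pi.single i 1) (gaussian d ha))‖ ^ 2
        = (k i + 1) * ‖schwartzIncl d (raisingMonomial s t k (gaussian d ha))‖ ^ 2 := by
      exact_mod_cast h1
    rw [h2, ih, prod_factorial_add_single]
    push_cast
    ring

/-- The normalization constant of `raisingMonomial s t k (gaussian d ha)`. -/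
def hermiteNorm (d : ℕ) {a : ℝ} (ha : 0 < a) (k : Fin d → ℕ) : ℝ :=
  √(∏ j, (k j).factorial : ℕ) * ‖schwartzIncl d (gaussian d ha)‖

theorem hermiteNorm_pos {a : ℝ} (ha : 0 < a) (k : Fin d → ℕ) : 0 < hermiteNorm d ha k := by
  have h1 : 0 < ‖schwartzIncl d (gaussian d ha)‖ :=
    norm_pos_iff.mpr (schwartzIncl_gaussian_ne_zero ha)
  have h2 : 0 < ∏ j, (k j).factorial := Finset.prod_pos fun _ _ => Nat.factorial_pos _
  unfold hermiteNorm
  positivity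

theorem hermiteNorm_add_single {a : ℝ} (ha : 0 < a) (k : Fin d → ℕ) (i : Fin d) :
    hermiteNorm d ha (k + Pi.single i 1) = √(k i + 1) * hermiteNorm d ha k := by
  rw [hermiteNorm, hermiteNorm, prod_factorial_add_single, Nat.cast_mul, Real.sqrt_mul (Nat.cast_nonneg _)]
  push_cast
  ring

/-- The normalized Hermite functions: eigenfunctions of the oscillator. -/
def hermite (d : ℕ) (s t : ℝ) {a : ℝ} (ha : 0 < a) (k : Fin d → ℕ) : 𝓢(Space d, ℂ) :=
  ((hermiteNorm d ha k)⁻¹ : ℂ) • raisingMonomial s t k (gaussian d ha)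

theorem isLadder_hermite (ht : 0 < t) (hst : 2 * s * t = 1) (ha : 0 < s / (2 * t)) :
    IsLadder s t 1 (hermite d s t ha) := by
  have hpos := hermiteNorm_pos (d := d) ha
  have hne (k : Fin d → ℕ) : (hermiteNorm d ha k : ℂ) ≠ 0 := by exact_mod_cast (hpos k).ne'
  have hsq (k : Fin d → ℕ) (j : Fin d) : (√(k j + 1) : ℂ) ≠ 0 := by
    have : 0 < √((k j : ℝ) + 1) := by positivity
    exact_mod_cast this.ne'
  refine ⟨fun k => ?_, fun j k => ?_, fun j k => ?_⟩
  · rw [hermite, map_smul, norm_smul]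
    have h1 := norm_sq_raisingMonomial_gaussian ht hst ha k
    have h2 : ‖schwartzIncl d (raisingMonomial s t k (gaussian d ha))‖ = hermiteNorm d ha k := by
      rw [← Real.sqrt_sq (norm_nonneg (schwartzIncl d (raisingMonomial s t k _))), h1,
        Real.sqrt_mul (Nat.cast_nonneg _), Real.sqrt_sq (norm_nonneg _), hermiteNorm]
    rw [h2, norm_inv, Complex.norm_real, Real.norm_of_nonneg (hpos k).le,
      inv_mul_cancel₀ (hpos k).ne']
  · rw [hermite, map_smul, lowering_raisingMonomial_gaussian ht hst ha, hermite, smul_smul,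
      smul_smul, one_mul]
    rcases Nat.eq_zero_or_pos (k j) with hk | hk
    · simp [hk]
    · congr 1
      obtain ⟨l, rfl⟩ : ∃ l : Fin d → ℕ, k = l + Pi.single j 1 :=
        ⟨_, (sub_single_add_single hk.ne').symm⟩
      rw [add_single_sub_single, hermiteNorm_add_single]
      have hl := hne l
      have hl' := hsq l j
      have h3 : (√(l j + 1) : ℂ) * √(l j + 1) = l j + 1 := by
        rw [← Complex.ofReal_mul, Real.mul_self_sqrt (by positivity)]
        push_cast
        rfl
      simp only [Pi.add_apply, Pi.single_eq_same]
      push_cast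
      field_simp
      linear_combination -h3
  · rw [hermite, map_smul, ← Module.End.mul_apply, ← raisingMonomial_add_single, hermite,
      smul_smul, hermiteNorm_add_single]
    congr 1
    have hl := hne k
    have hl' := hsq k j
    simp only [map_one, one_mul]
    push_cast
    field_simp

end Hermite

end Ladder


/-! ### Completeness of the Hermite functions. -/

section Completeness

variable {d : ℕ}

/-- An integrable function with vanishing Fourier transform vanishes almost everywhere. -/
theorem ae_eq_zero_of_fourier_eq_zero {g : Space d → ℂ} (hg : Integrable g)
    (h : ∀ ξ, 𝓕 g ξ = 0) : ∀ᵐ x, g x = 0 := by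
  refine ae_eq_zero_of_integral_contDiff_smul_eq_zero hg.locallyIntegrable fun χ hχ hχc => ?_
  let φ : 𝓢(Space d, ℂ) := (hχc.toSchwartzMap hχ).postcompCLM Complex.ofRealCLM
  -- The Fourier transform moves across the pairing: `∫ 𝓕 g * 𝓕⁻ χ = ∫ g * χ`, and the left side is
  -- zero.
  have h1 := VectorFourier.integral_fourierIntegral_smul_eq_flip (L := innerₗ (Space d))
    Real.continuous_fourierChar continuous_inner hg (𝓕⁻ φ).integrable (μ := volume) (ν := volume)
  have h2 (x : Space d) :
      VectorFourier.fourierIntegral Real.fourierChar volume (innerₗ (Space d)).flip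
        (𝓕⁻ φ : 𝓢(Space d, ℂ)) x = χ x := by
    rw [flip_innerₗ]
    change 𝓕 ((𝓕⁻ φ : 𝓢(Space d, ℂ)) : Space d → ℂ) x = χ x
    rw [← fourier_coe, FourierTransform.fourier_fourierInv_eq]
    rfl
  have h3 (ξ : Space d) :
      VectorFourier.fourierIntegral Real.fourierChar volume (innerₗ (Space d)) g ξ = 0 := h ξ
  simp only [h2, h3, zero_mul, integral_zero, smul_eq_mul] at h1
  rw [h1]
  refine integral_congr_ae (Filter.Eventually.of_forall fun x => ?_)
  simp [mul_comm]

/-- Completing the square: half of the Gaussian's rate absorbs the exponential. This gives an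
integrable majorant for the exponential series times a Gaussian. -/
theorem exp_mul_gaussian_le {a : ℝ} (ha : 0 < a) (c : ℝ) (x : Space d) :
    Real.exp (c * ‖x‖) * Real.exp (-(a * ‖x‖ ^ 2)) ≤
      Real.exp (c ^ 2 / (2 * a)) * Real.exp (-(a / 2 * ‖x‖ ^ 2)) := by
  rw [← Real.exp_add, ← Real.exp_add]
  refine Real.exp_le_exp.mpr ?_
  have : c ^ 2 / (2 * a) + -(a / 2 * ‖x‖ ^ 2) - (c * ‖x‖ + -(a * ‖x‖ ^ 2)) =
      a / 2 * (‖x‖ - c / a) ^ 2 := by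
    field_simp
    ring
  nlinarith [mul_nonneg ha.le (sq_nonneg (‖x‖ - c / a))]

/-- A square integrable function orthogonal to all polynomials times a Gaussian vanishes. -/
theorem eq_zero_of_integral_inner_pow_mul_gaussian {a : ℝ} (ha : 0 < a) (f : L2 d)
    (hf : ∀ (ξ : Space d) (m : ℕ),
      ∫ x, ((⟪ξ, x⟫_ℝ : ℝ) : ℂ) ^ m * gaussian d ha x * f x = 0) : f = 0 := by
  have hprod (b : ℝ) (hb : 0 < b) : Integrable fun x => gaussian d hb x * f x :=
    ((gaussian d hb).memLp 2).integrable_mul (Lp.memLp f)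
  have hint := hprod a ha
  have hzero : ∀ᵐ x, gaussian d ha x * f x = 0 := by
    refine ae_eq_zero_of_fourier_eq_zero hint fun ξ => ?_
    set η : Space d := (2 * Real.pi) • ξ with hη
    -- The Fourier transform is integrated term by term along the power series of `exp (-i⟨η, x⟩)`;
    -- every term is a vanishing moment.
    have hsum := hasSum_integral_of_dominated_convergence (μ := (volume : Measure (Space d)))
      (F := fun (m : ℕ) x =>
        ((-Complex.I) ^ m / m.factorial) * (((⟪η, x⟫_ℝ : ℝ) : ℂ) ^ m * gaussian d ha x * f x))
      (f := fun x => Complex.exp (-Complex.I * (⟪η, x⟫_ℝ : ℝ)) * (gaussian d ha x * f x))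
      (fun m x => |⟪η, x⟫_ℝ| ^ m / m.factorial * ‖gaussian d ha x * f x‖)
      (fun m => ?_) (fun m => ?_) ?_ ?_ ?_
    · have h0 : ∫ x, Complex.exp (-Complex.I * (⟪η, x⟫_ℝ : ℝ)) * (gaussian d ha x * f x) = 0 := by
        refine hsum.unique ?_
        simp only [integral_const_mul, hf, mul_zero]
        exact hasSum_zero
      rw [← h0, Real.fourier_eq']
      refine integral_congr_ae (Filter.Eventually.of_forall fun x => ?_)
      simp only [smul_eq_mul, hη, inner_smul_left, real_inner_comm x ξ]
      congr 2
      simp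
      ring
    · refine AEStronglyMeasurable.const_mul (AEStronglyMeasurable.mul (AEStronglyMeasurable.mul ?_
        (gaussian d ha).continuous.aestronglyMeasurable) (Lp.aestronglyMeasurable f)) _
      exact Continuous.aestronglyMeasurable (by fun_prop)
    · refine Filter.Eventually.of_forall fun x => le_of_eq ?_
      simp only [norm_mul, norm_div, norm_pow, norm_neg, Complex.norm_I, one_pow,
        Complex.norm_real, Real.norm_eq_abs, Complex.norm_natCast]
      ring
    · exact Filter.Eventually.of_forall fun x =>
        (Real.summable_pow_div_factorial _).mul_right _
    · have he (x : Space d) : ∑' m : ℕ, |⟪η, x⟫_ℝ| ^ m / m.factorial * ‖gaussian d ha x * f x‖ =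
          Real.exp |⟪η, x⟫_ℝ| * ‖gaussian d ha x * f x‖ := by
        rw [tsum_mul_right, Real.exp_eq_exp_ℝ, NormedSpace.exp_eq_tsum_div]
      simp only [he]
      refine ((hprod (a / 2) (by positivity)).norm.const_mul
        (Real.exp (‖η‖ ^ 2 / (2 * a)))).mono' ?_ ?_
      · exact (Continuous.aestronglyMeasurable (by fun_prop)).mul hint.norm.aestronglyMeasurable
      · refine Filter.Eventually.of_forall fun x => ?_
        rw [norm_mul, norm_norm, Real.norm_of_nonneg (Real.exp_nonneg _), norm_mul, norm_mul,
          ← mul_assoc, ← mul_assoc]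
        gcongr ?_ * _
        simp only [gaussian_apply, Complex.norm_real, Real.norm_of_nonneg (Real.exp_nonneg _)]
        refine le_trans ?_ (exp_mul_gaussian_le ha ‖η‖ x)
        gcongr
        exact abs_real_inner_le_norm η x
    · refine Filter.Eventually.of_forall fun x => ?_
      have h1 := NormedSpace.expSeries_div_hasSum_exp (𝔸 := ℂ)
        (-Complex.I * ((⟪η, x⟫_ℝ : ℝ) : ℂ))
      rw [← Complex.exp_eq_exp_ℂ] at h1
      refine (congrArg (HasSum · _) (funext fun m => ?_)).mp
        (h1.mul_right (gaussian d ha x * f x))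
      rw [mul_pow]
      ring
  apply Lp.ext
  filter_upwards [hzero, Lp.coeFn_zero ℂ 2 (volume : Measure (Space d))] with x hx h0
  rw [h0]
  refine (mul_eq_zero.mp hx).resolve_left ?_
  rw [gaussian_apply]
  exact_mod_cast (Real.exp_pos _).ne'

variable {s t : ℝ}

/-- Because `2 s x_j` is lowering plus raising, and both preserve the span of the monomials. -/
theorem position_mem_span_raisingMonomial (hs : 0 < s) (ht : 0 < t) (hst : 2 * s * t = 1)
    (ha : 0 < s / (2 * t)) (j : Fin d) {φ : 𝓢(Space d, ℂ)}
    (hφ : φ ∈ Submodule.span ℂ (Set.range fun k => raisingMonomial s t k (gaussian d ha))) :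
    position d j φ ∈
      Submodule.span ℂ (Set.range fun k => raisingMonomial s t k (gaussian d ha)) := by
  set W := Submodule.span ℂ (Set.range fun k => raisingMonomial s t k (gaussian d ha))
  have hs' : (s : ℂ) ≠ 0 := by exact_mod_cast hs.ne'
  have hX : position d j φ = (2 * s : ℂ)⁻¹ • (lowering s t j φ + raising s t j φ) := by
    rw [lowering_add_raising, smul_smul, inv_mul_cancel₀ (by simpa using hs'), one_smul]
  rw [hX]
  refine Submodule.smul_mem _ _ ?_
  change (lowering s t j + raising s t j) φ ∈ _
  suffices h : W ≤ W.comap (lowering s t j + raising s t j) from h hφ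
  refine Submodule.span_le.mpr ?_
  rintro _ ⟨k, rfl⟩
  change lowering s t j (raisingMonomial s t k (gaussian d ha)) +
    raising s t j (raisingMonomial s t k (gaussian d ha)) ∈ W
  refine Submodule.add_mem _ ?_ ?_
  · rw [lowering_raisingMonomial_gaussian ht hst ha]
    exact Submodule.smul_mem _ _ (Submodule.subset_span ⟨_, rfl⟩)
  · rw [← Module.End.mul_apply, ← raisingMonomial_add_single]
    exact Submodule.subset_span ⟨_, rfl⟩

/-- Multiplication by the linear function `⟨ξ, x⟩` on Schwartz functions. -/
def linearPosition (ξ : Space d) : Module.End ℂ 𝓢(Space d, ℂ) :=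
  ∑ j, (ξ j : ℂ) • (position d j).toLinearMap

theorem linearPosition_apply (ξ : Space d) (φ : 𝓢(Space d, ℂ)) (x : Space d) :
    linearPosition ξ φ x = ((⟪ξ, x⟫_ℝ : ℝ) : ℂ) * φ x := by
  have h : linearPosition ξ φ = ∑ j, (ξ j : ℂ) • position d j φ := by
    simp [linearPosition, LinearMap.sum_apply]
  rw [h, sum_apply, PiLp.inner_apply]
  simp only [smul_apply, smul_eq_mul, position_apply, Complex.ofReal_sum, Finset.sum_mul]
  refine Finset.sum_congr rfl fun j _ => ?_
  simp
  ring

theorem linearPosition_pow_apply (ξ : Space d) (m : ℕ) (φ : 𝓢(Space d, ℂ)) (x : Space d) :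
    (linearPosition ξ ^ m) φ x = ((⟪ξ, x⟫_ℝ : ℝ) : ℂ) ^ m * φ x := by
  induction m with
  | zero => simp
  | succ m ih => rw [pow_succ', Module.End.mul_apply, linearPosition_apply, ih, pow_succ]; ring

/-- The span contains the Gaussian and is stable under each `x_j`, hence contains `⟨ξ, x⟩ ^ m` times
the Gaussian; a function orthogonal to all of these vanishes. -/
theorem span_hermite_orthogonal (hs : 0 < s) (ht : 0 < t) (hst : 2 * s * t = 1)
    (ha : 0 < s / (2 * t)) :
    (Submodule.span ℂ (Set.range fun k => schwartzIncl d (hermite d s t ha k)))ᗮ = ⊥ := by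
  rw [Submodule.eq_bot_iff]
  intro f hf
  set W := Submodule.span ℂ (Set.range fun k => raisingMonomial s t k (gaussian d ha))
  have hW {φ : 𝓢(Space d, ℂ)} (hφ : φ ∈ W) : ⟪schwartzIncl d φ, f⟫_ℂ = 0 := by
    rw [← Submodule.mem_orthogonal_singleton_iff_inner_left, ← Submodule.mem_comap]
    refine Submodule.span_le.mpr ?_ hφ
    rintro _ ⟨k, rfl⟩
    have hne : (hermiteNorm d ha k : ℂ) ≠ 0 := by exact_mod_cast (hermiteNorm_pos ha k).ne'
    have h1 : raisingMonomial s t k (gaussian d ha) =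
        (hermiteNorm d ha k : ℂ) • hermite d s t ha k := by
      rw [hermite, smul_smul, mul_inv_cancel₀ hne, one_smul]
    change raisingMonomial s t k (gaussian d ha) ∈ _
    rw [h1]
    refine Submodule.smul_mem _ _ ?_
    rw [Submodule.mem_comap, Submodule.mem_orthogonal_singleton_iff_inner_left]
    exact hf _ (Submodule.subset_span ⟨k, rfl⟩)
  refine eq_zero_of_integral_inner_pow_mul_gaussian ha f fun ξ m => ?_
  have hmem : (linearPosition ξ ^ m) (gaussian d ha) ∈ W := by
    induction m with
    | zero =>
      exact Submodule.subset_span ⟨0, by simp [raisingMonomial_zero]⟩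
    | succ m ih =>
      rw [pow_succ', Module.End.mul_apply]
      have h : ∀ φ : 𝓢(Space d, ℂ), linearPosition ξ φ = ∑ j, (ξ j : ℂ) • position d j φ :=
        fun φ => by simp [linearPosition, LinearMap.sum_apply]
      rw [h]
      exact Submodule.sum_mem _ fun j _ => Submodule.smul_mem _ _
        (position_mem_span_raisingMonomial hs ht hst ha j ih)
  have h1 := hW hmem
  rw [L2.inner_def] at h1
  rw [← h1]
  refine integral_congr_ae ?_
  filter_upwards [coeFn_toLp ((linearPosition ξ ^ m) (gaussian d ha)) 2 volume] with x hx
  have hx' : (schwartzIncl d ((linearPosition ξ ^ m) (gaussian d ha)) : Space d → ℂ) x =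
    (linearPosition ξ ^ m) (gaussian d ha) x := hx
  rw [hx', RCLike.inner_apply', linearPosition_pow_apply, map_mul, map_pow,
    Complex.conj_ofReal, gaussian_apply, Complex.conj_ofReal]

/-- The Hilbert basis of Hermite functions. -/
def hermiteBasis (d : ℕ) {s t : ℝ} (hs : 0 < s) (ht : 0 < t) (hst : 2 * s * t = 1)
    (ha : 0 < s / (2 * t)) : HilbertBasis (Fin d → ℕ) ℂ (L2 d) :=
  HilbertBasis.mkOfOrthogonalEqBot (isLadder_hermite ht hst ha).orthonormal
    (span_hermite_orthogonal hs ht hst ha)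

theorem hermiteBasis_apply (hs : 0 < s) (ht : 0 < t) (hst : 2 * s * t = 1)
    (ha : 0 < s / (2 * t)) (k : Fin d → ℕ) :
    hermiteBasis d hs ht hst ha k = schwartzIncl d (hermite d s t ha k) := by
  rw [hermiteBasis, HilbertBasis.coe_mkOfOrthogonalEqBot]

end Completeness


/-! ### Spectral decomposition of the Hamiltonian and of `expNeg`. -/

section Oscillator

theorem summable_pow_sum (d : ℕ) {r : ℝ} (h0 : 0 ≤ r) (h1 : r < 1) :
    Summable fun k : Fin d → ℕ => r ^ ∑ j, k j := by
  induction d with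
  | zero => exact Summable.of_finite
  | succ d ih =>
    rw [← (Fin.consEquiv fun _ : Fin (d + 1) => ℕ).summable_iff]
    refine ((summable_geometric_of_lt_one h0 h1).mul_of_nonneg ih (fun _ => by positivity)
      fun _ => by positivity).congr fun p => ?_
    simp [Fin.sum_univ_succ, Fin.consEquiv, pow_add]

theorem inner_apply_of_diagonal {E : Type} [NormedAddCommGroup E] [InnerProductSpace ℂ E]
    {κ : Type} (b : HilbertBasis κ ℂ E) {G : E →L[ℂ] E} {c : κ → ℝ}
    (hG : ∀ k, G (b k) = (c k : ℂ) • b k) (ψ : E) (k : κ) :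
    ⟪b k, G ψ⟫_ℂ = c k * ⟪b k, ψ⟫_ℂ := by
  classical
  have h1 := ((b.hasSum_repr ψ).mapL G).mapL (innerSL ℂ (b k))
  refine h1.unique ?_
  refine (congrArg (HasSum · _) (funext fun j => ?_)).mp
    (hasSum_ite_eq k (c k * ⟪b k, ψ⟫_ℂ))
  rw [map_smul, map_smul, hG, map_smul, innerSL_apply_apply,
    orthonormal_iff_ite.mp b.orthonormal k j, HilbertBasis.repr_apply_apply]
  by_cases h : j = k
  · subst h
    simp
    ring
  · simp [h, Ne.symm h]

variable {d : ℕ}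

theorem oscillatorSchwartz_apply (ħ : ℝ) (φ : 𝓢(Space d, ℂ)) :
    oscillatorSchwartz d ħ φ = (1 / 2 : ℂ) • ∑ j : Fin d,
      ((-(ħ : ℂ) ^ 2) • partialDeriv d j (partialDeriv d j φ) +
        position d j (position d j φ)) := by
  simp only [oscillatorSchwartz, momentum_eq, smul_apply, sum_apply, add_apply,
    ContinuousLinearMap.comp_apply, map_smul, smul_smul]
  congr 1
  refine Finset.sum_congr rfl fun j _ => ?_
  congr 2
  linear_combination (ħ : ℂ) ^ 2 * Complex.I_sq

theorem inner_oscillatorSchwartz (ħ : ℝ) (φ ψ : 𝓢(Space d, ℂ)) :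
    ⟪schwartzIncl d φ, schwartzIncl d (oscillatorSchwartz d ħ ψ)⟫_ℂ =
      ⟪schwartzIncl d (oscillatorSchwartz d ħ φ), schwartzIncl d ψ⟫_ℂ := by
  simp only [oscillatorSchwartz_apply, map_smul, map_sum, map_add, inner_smul_left,
    inner_smul_right, sum_inner, inner_sum, inner_add_left, inner_add_right, inner_position,
    inner_partialDeriv]
  have h2 : (starRingEnd ℂ) 2 = 2 := map_ofNat (starRingEnd ℂ) 2
  simp [h2]

/-- With `t = ħ s`, `a† a + a a† = 2 s² (x_j² - ħ² ∂_j²)`, and `2 s² ħ = 1` turns this into `x_j² -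
ħ² ∂_j² = ħ (a† a + a a†)`, with eigenvalue `ħ (2 k_j + 1)`. -/
theorem IsLadder.oscillatorSchwartz_eq {s t ħ : ℝ} (ht : t = ħ * s) (hst : 2 * s * t = 1)
    {u : (Fin d → ℕ) → 𝓢(Space d, ℂ)} (h : IsLadder s t 1 u) (k : Fin d → ℕ) :
    oscillatorSchwartz d ħ (u k) = ((ħ * ((∑ j, k j : ℕ) + d / 2) : ℝ) : ℂ) • u k := by
  have h1 : (2 * s * (ħ * s) : ℂ) = 1 := by rw [ht] at hst; exact_mod_cast hst
  have hj (j : Fin d) : (-(ħ : ℂ) ^ 2) • partialDeriv d j (partialDeriv d j (u k)) +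
      position d j (position d j (u k)) = (ħ * (2 * k j + 1) : ℂ) • u k := by
    have e1 := h.raising_lowering j k
    have e2 := h.lowering_raising j k
    simp only [lowering_apply, raising_apply, map_add, map_sub, map_smul, map_one, one_mul, ht,
      Complex.ofReal_mul] at e1 e2
    set v := (-(ħ : ℂ) ^ 2) • partialDeriv d j (partialDeriv d j (u k)) +
      position d j (position d j (u k)) with hv
    -- Inserting the factor `1 = 2 s (ħ s)` makes the goal a linear combination of the two
    -- number-operator identities, checked by `module`.
    have e3 : v = (2 * s * (ħ * s) : ℂ) • v := by rw [h1, one_smul]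
    rw [e3, hv]
    linear_combination (norm := module) (ħ : ℂ) • e1 + (ħ : ℂ) • e2
  rw [oscillatorSchwartz_apply, Finset.sum_congr rfl fun j _ => hj j, ← Finset.sum_smul, smul_smul]
  congr 1
  rw [← Finset.mul_sum, Finset.sum_add_distrib, ← Finset.mul_sum]
  push_cast
  simp
  ring

theorem dense_oscillatorMin (ħ : ℝ) : Dense ((oscillatorMin d ħ).domain : Set (L2 d)) := by
  have := denseRange_toLpCLM (E := Space d) (F := ℂ) (μ := volume) (p := 2) (by simp)
  exact this

theorem oscillatorMin_apply (ħ : ℝ) (φ : 𝓢(Space d, ℂ)) :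
    oscillatorMin d ħ ⟨schwartzIncl d φ, φ, rfl⟩ = schwartzIncl d (oscillatorSchwartz d ħ φ) := by
  have h : (LinearEquiv.ofInjective (schwartzIncl d) (schwartzIncl_injective d)).symm
      ⟨schwartzIncl d φ, φ, rfl⟩ = φ := by
    rw [LinearEquiv.symm_apply_eq]
    rfl
  change schwartzIncl d (oscillatorSchwartz d ħ ((LinearEquiv.ofInjective (schwartzIncl d)
    (schwartzIncl_injective d)).symm ⟨schwartzIncl d φ, φ, rfl⟩)) = _
  rw [h]

theorem inner_hamiltonian {ħ : ℝ} {e : (Fin d → ℕ) → ℝ} {u : (Fin d → ℕ) → 𝓢(Space d, ℂ)}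
    (b : HilbertBasis (Fin d → ℕ) ℂ (L2 d)) (hb : ∀ k, b k = schwartzIncl d (u k))
    (hu : ∀ k, oscillatorSchwartz d ħ (u k) = (e k : ℂ) • u k)
    (ψ : (hamiltonian d ħ).domain) (k : Fin d → ℕ) :
    ⟪b k, hamiltonian d ħ ψ⟫_ℂ = e k * ⟪b k, (ψ : L2 d)⟫_ℂ := by
  have h : ⟪hamiltonian d ħ ψ, schwartzIncl d (u k)⟫_ℂ =
      ⟪(ψ : L2 d), oscillatorMin d ħ ⟨schwartzIncl d (u k), u k, rfl⟩⟫_ℂ :=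
    LinearPMap.adjoint_isFormalAdjoint (dense_oscillatorMin (d := d) ħ) ψ
      ⟨schwartzIncl d (u k), u k, rfl⟩
  rw [oscillatorMin_apply, hu, map_smul, inner_smul_right, ← hb] at h
  have h' := congrArg (starRingEnd ℂ) h
  rw [inner_conj_symm, map_mul, inner_conj_symm, Complex.conj_ofReal] at h'
  exact h'

/-- This carries the content of essential self-adjointness: the adjoint domain is the maximal domain
of the diagonal operator. Forward is Bessel for `H ψ`; conversely the vector with coefficients `e k
* ⟪b k, ψ⟫` satisfies the defining relation of the adjoint, by Parseval. -/
theorem mem_hamiltonian_domain_iff {ħ : ℝ} {e : (Fin d → ℕ) → ℝ} {u : (Fin d → ℕ) → 𝓢(Space d, ℂ)}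
    (b : HilbertBasis (Fin d → ℕ) ℂ (L2 d)) (hb : ∀ k, b k = schwartzIncl d (u k))
    (hu : ∀ k, oscillatorSchwartz d ħ (u k) = (e k : ℂ) • u k)
    (ψ : L2 d) :
    ψ ∈ (hamiltonian d ħ).domain ↔ Summable fun k => ‖(e k : ℂ) * ⟪b k, ψ⟫_ℂ‖ ^ 2 := by
  constructor
  · intro h
    have := b.orthonormal.inner_products_summable (hamiltonian d ħ ⟨ψ, h⟩)
    simpa only [inner_hamiltonian b hb hu] using this
  · intro h
    have hmem : Memℓp (fun k => (e k : ℂ) * ⟪b k, ψ⟫_ℂ) 2 := by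
      refine memℓp_gen ?_
      simpa using h
    set w : L2 d := b.repr.symm ⟨_, hmem⟩ with hw
    have hwk (k : Fin d → ℕ) : ⟪b k, w⟫_ℂ = e k * ⟪b k, ψ⟫_ℂ := by
      rw [← HilbertBasis.repr_apply_apply, hw, LinearIsometryEquiv.apply_symm_apply]
    refine LinearPMap.mem_adjoint_domain_of_exists ψ ⟨w, ?_⟩
    rintro ⟨_, φ, rfl⟩
    rw [oscillatorMin_apply, ← b.tsum_inner_mul_inner, ← b.tsum_inner_mul_inner]
    refine tsum_congr fun k => ?_
    have h1 : ⟪w, b k⟫_ℂ = e k * ⟪ψ, b k⟫_ℂ := by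
      rw [← inner_conj_symm, hwk, map_mul, inner_conj_symm, Complex.conj_ofReal]
    have h2 : ⟪b k, schwartzIncl d (oscillatorSchwartz d ħ φ)⟫_ℂ =
        e k * ⟪b k, schwartzIncl d φ⟫_ℂ := by
      rw [hb, inner_oscillatorSchwartz, hu, map_smul, inner_smul_left, Complex.conj_ofReal]
    rw [h1, h2]
    ring

/-- An explicit diagonal operator shows that the choice in `expNeg` is not vacuous; on eigenvectors
any choice gives the same value. -/
theorem expNeg_hamiltonian_apply {ħ : ℝ} {e : (Fin d → ℕ) → ℝ} {u : (Fin d → ℕ) → 𝓢(Space d, ℂ)}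
    (b : HilbertBasis (Fin d → ℕ) ℂ (L2 d)) (hb : ∀ k, b k = schwartzIncl d (u k))
    (hu : ∀ k, oscillatorSchwartz d ħ (u k) = (e k : ℂ) • u k)
    {β : ℝ} (hβ : Summable fun k => Real.exp (-β * e k))
    (k : Fin d → ℕ) :
    expNeg β (hamiltonian d ħ) (b k) = (Real.exp (-β * e k) : ℂ) • b k := by
  have hs : Summable fun k => ‖(Real.exp (-β * e k) : ℂ) • b k‖ := by
    simpa only [norm_smul, b.orthonormal.norm_eq_one, mul_one, Complex.norm_real,
      Real.norm_of_nonneg (Real.exp_nonneg _)] using hβ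
  have hex : ∃ G, IsFunctionOf (fun t => Real.exp (-β * t)) (hamiltonian d ħ) G :=
    ⟨rankOneSum b fun k => (Real.exp (-β * e k) : ℂ) • b k,
      isFunctionOf_of_diagonal b (mem_hamiltonian_domain_iff b hb hu) (inner_hamiltonian b hb hu)
        (inner_apply_of_diagonal b (rankOneSum_basis b hs))⟩
  rw [expNeg, dif_pos hex]
  have hdom : b k ∈ (hamiltonian d ħ).domain := by
    classical
    rw [mem_hamiltonian_domain_iff b hb hu]
    refine summable_of_ne_finset_zero (s := {k}) fun j hj => ?_
    rw [orthonormal_iff_ite.mp b.orthonormal, if_neg (by simpa using hj)]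
    simp
  refine hex.choose_spec.apply_eigenvector ⟨b k, hdom⟩ ?_
  refine (b.repr.injective ?_)
  ext j
  rw [HilbertBasis.repr_apply_apply, HilbertBasis.repr_apply_apply, inner_hamiltonian b hb hu,
    inner_smul_right]
  rcases eq_or_ne j k with h | h
  · rw [h]
  · change _ * ⟪b j, b k⟫_ℂ = _ * ⟪b j, b k⟫_ℂ
    rw [b.orthonormal.inner_eq_zero h, mul_zero, mul_zero]

end Oscillator


/-! ### Plane waves and their matrix elements. -/

section Phase

open scoped ContDiff

variable {d : ℕ}

theorem iteratedDeriv_cexp_I_mul (n : ℕ) :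
    iteratedDeriv n (fun t : ℝ => Complex.exp (Complex.I * t)) =
      fun t : ℝ => Complex.I ^ n * Complex.exp (Complex.I * t) := by
  induction n with
  | zero => ext t; simp
  | succ n ih =>
    ext t
    rw [iteratedDeriv_succ, ih]
    have h1 : HasDerivAt (fun t : ℝ => Complex.I * (t : ℂ)) Complex.I t := by
      simpa using (Complex.ofRealCLM.hasDerivAt (x := t)).const_mul Complex.I
    rw [(h1.cexp.const_mul (Complex.I ^ n)).deriv, pow_succ]
    ring

theorem hasTemperateGrowth_cexp_I_mul :
    Function.HasTemperateGrowth fun t : ℝ => Complex.exp (Complex.I * t) := by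
  refine ⟨(contDiff_const.mul Complex.ofRealCLM.contDiff).cexp, fun n => ⟨0, 1, fun t => ?_⟩⟩
  rw [norm_iteratedFDeriv_eq_norm_iteratedDeriv, iteratedDeriv_cexp_I_mul, norm_mul, norm_pow,
    Complex.norm_I, mul_comm Complex.I, Complex.norm_exp_ofReal_mul_I]
  simp

/-- The plane wave `exp (i ⟨ξ, x⟩)`. -/
def planeWave (ξ x : Space d) : ℂ := Complex.exp (Complex.I * (⟪ξ, x⟫_ℝ : ℝ))

theorem hasTemperateGrowth_planeWave (ξ : Space d) :
    Function.HasTemperateGrowth (planeWave ξ) :=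
  hasTemperateGrowth_cexp_I_mul.comp (Function.hasTemperateGrowth_inner_right ξ)

theorem conj_planeWave_mul (ξ x : Space d) :
    (starRingEnd ℂ) (planeWave ξ x) * planeWave ξ x = 1 := by
  rw [planeWave, ← Complex.exp_conj, ← Complex.exp_add]
  simp

theorem norm_planeWave (ξ x : Space d) : ‖planeWave ξ x‖ = 1 := by
  rw [planeWave, mul_comm, Complex.norm_exp_ofReal_mul_I]

theorem continuous_planeWave (ξ : Space d) : Continuous (planeWave ξ) := by
  unfold planeWave
  fun_prop

/-- Multiplication by the plane wave `exp (i ⟨ξ, x⟩)` on Schwartz functions. -/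
def mulPlaneWave (ξ : Space d) : 𝓢(Space d, ℂ) →L[ℂ] 𝓢(Space d, ℂ) :=
  smulLeftCLM ℂ (planeWave ξ)

theorem mulPlaneWave_apply (ξ : Space d) (φ : 𝓢(Space d, ℂ)) (x : Space d) :
    mulPlaneWave ξ φ x = planeWave ξ x * φ x := by
  rw [mulPlaneWave, smulLeftCLM_apply_apply (hasTemperateGrowth_planeWave ξ), smul_eq_mul]

theorem norm_mulPlaneWave (ξ : Space d) (φ : 𝓢(Space d, ℂ)) :
    ‖schwartzIncl d (mulPlaneWave ξ φ)‖ = ‖schwartzIncl d φ‖ := by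
  have h : ⟪schwartzIncl d (mulPlaneWave ξ φ), schwartzIncl d (mulPlaneWave ξ φ)⟫_ℂ =
      ⟪schwartzIncl d φ, schwartzIncl d φ⟫_ℂ := by
    rw [inner_schwartzIncl, inner_schwartzIncl]
    refine integral_congr_ae (Filter.Eventually.of_forall fun x => ?_)
    simp only [mulPlaneWave_apply, map_mul]
    rw [mul_mul_mul_comm, conj_planeWave_mul, one_mul]
  rw [inner_self_eq_norm_sq_to_K, inner_self_eq_norm_sq_to_K] at h
  have h' : ‖schwartzIncl d (mulPlaneWave ξ φ)‖ ^ 2 = ‖schwartzIncl d φ‖ ^ 2 := by exact_mod_cast h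
  exact (pow_left_inj₀ (norm_nonneg _) (norm_nonneg _) two_ne_zero).mp h'

theorem position_mulPlaneWave (ξ : Space d) (j : Fin d) (φ : 𝓢(Space d, ℂ)) :
    position d j (mulPlaneWave ξ φ) = mulPlaneWave ξ (position d j φ) := by
  ext x
  simp only [position_apply, mulPlaneWave_apply]
  ring

theorem partialDeriv_mulPlaneWave (ξ : Space d) (j : Fin d) (φ : 𝓢(Space d, ℂ)) :
    partialDeriv d j (mulPlaneWave ξ φ) =
      (Complex.I * ξ j) • mulPlaneWave ξ φ + mulPlaneWave ξ (partialDeriv d j φ) := by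
  ext x
  have h1 : HasFDerivAt (fun x : Space d => Complex.I * ((⟪ξ, x⟫_ℝ : ℝ) : ℂ)) _ x :=
    ((Complex.ofRealCLM.comp (innerSL ℝ ξ)).hasFDerivAt (x := x)).const_mul Complex.I
  have h2 : HasFDerivAt (planeWave ξ) _ x := h1.cexp
  rw [mulPlaneWave, partialDeriv_smulLeftCLM (hasTemperateGrowth_planeWave ξ), h2.fderiv,
    ← mulPlaneWave, add_apply, mulPlaneWave_apply]
  simp only [smul_apply, mulPlaneWave_apply]
  simp [EuclideanSpace.inner_single_right, planeWave]
  ring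

/-- The plane wave commutes with `x_j`, so only `t ∂_j` contributes to the commutator, by the scalar
`t i ξ_j`. -/
theorem lowering_mulPlaneWave (s t : ℝ) (ξ : Space d) (j : Fin d) (φ : 𝓢(Space d, ℂ)) :
    lowering s t j (mulPlaneWave ξ φ) =
      mulPlaneWave ξ (lowering s t j φ) + (t * (Complex.I * ξ j)) • mulPlaneWave ξ φ := by
  simp only [lowering_apply, position_mulPlaneWave, partialDeriv_mulPlaneWave, map_add, map_smul]
  module

theorem raising_mulPlaneWave (s t : ℝ) (ξ : Space d) (j : Fin d) (φ : 𝓢(Space d, ℂ)) :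
    raising s t j (mulPlaneWave ξ φ) =
      mulPlaneWave ξ (raising s t j φ) - (t * (Complex.I * ξ j)) • mulPlaneWave ξ φ := by
  simp only [raising_apply, position_mulPlaneWave, partialDeriv_mulPlaneWave, map_sub, map_smul]
  module

/-- The matrix element `⟨φ, exp (i ⟨ξ, x⟩) ψ⟩`. -/
def waveInner (ξ : Space d) (φ ψ : 𝓢(Space d, ℂ)) : ℂ :=
  ⟪schwartzIncl d φ, schwartzIncl d (mulPlaneWave ξ ψ)⟫_ℂ

theorem norm_waveInner_le (ξ : Space d) (φ ψ : 𝓢(Space d, ℂ)) :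
    ‖waveInner ξ φ ψ‖ ≤ ‖schwartzIncl d φ‖ * ‖schwartzIncl d ψ‖ := by
  rw [← norm_mulPlaneWave ξ ψ]
  exact norm_inner_le_norm _ _

theorem waveInner_smul_right (ξ : Space d) (c : ℂ) (φ ψ : 𝓢(Space d, ℂ)) :
    waveInner ξ φ (c • ψ) = c * waveInner ξ φ ψ := by
  rw [waveInner, map_smul, map_smul, inner_smul_right, waveInner]

theorem waveInner_smul_left (ξ : Space d) (c : ℂ) (φ ψ : 𝓢(Space d, ℂ)) :
    waveInner ξ (c • φ) ψ = (starRingEnd ℂ) c * waveInner ξ φ ψ := by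
  rw [waveInner, map_smul, inner_smul_left, waveInner]

theorem waveInner_add_right (ξ : Space d) (φ ψ η : 𝓢(Space d, ℂ)) :
    waveInner ξ φ (ψ + η) = waveInner ξ φ ψ + waveInner ξ φ η := by
  rw [waveInner, map_add, map_add, inner_add_right, waveInner, waveInner]

theorem waveInner_raising_left (s t : ℝ) (ξ : Space d) (j : Fin d) (φ ψ : 𝓢(Space d, ℂ)) :
    waveInner ξ (raising s t j φ) ψ =
      waveInner ξ φ (lowering s t j ψ) + t * (Complex.I * ξ j) * waveInner ξ φ ψ := by
  rw [waveInner, ← inner_lowering, lowering_mulPlaneWave, map_add, map_smul, inner_add_right,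
    inner_smul_right, waveInner, waveInner]

theorem waveInner_lowering_left (s t : ℝ) (ξ : Space d) (j : Fin d) (φ ψ : 𝓢(Space d, ℂ)) :
    waveInner ξ (lowering s t j φ) ψ =
      waveInner ξ φ (raising s t j ψ) - t * (Complex.I * ξ j) * waveInner ξ φ ψ := by
  rw [waveInner, ← inner_raising, raising_mulPlaneWave, map_sub, map_smul, inner_sub_right,
    inner_smul_right, waveInner, waveInner]

theorem waveInner_eq_integral (ξ : Space d) (φ ψ : 𝓢(Space d, ℂ)) :
    waveInner ξ φ ψ = ∫ x, planeWave ξ x * ((starRingEnd ℂ) (φ x) * ψ x) := by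
  rw [waveInner, inner_schwartzIncl]
  refine integral_congr_ae (Filter.Eventually.of_forall fun x => ?_)
  simp only [mulPlaneWave_apply]
  ring

theorem integrable_conj_mul (φ ψ : 𝓢(Space d, ℂ)) :
    Integrable fun x => (starRingEnd ℂ) (φ x) * ψ x :=
  (MemLp.star (φ.memLp 2)).integrable_mul (ψ.memLp 2)

/-- Differentiation under the integral: plane waves have modulus one, so `|φ| |⟨ξ, x⟩ ψ|` dominates
the derivative uniformly in `τ`. -/
theorem hasDerivAt_waveInner (ξ : Space d) (φ ψ : 𝓢(Space d, ℂ)) (τ : ℝ) :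
    HasDerivAt (fun τ : ℝ => waveInner (τ • ξ) φ ψ)
      (Complex.I * waveInner (τ • ξ) φ (linearPosition ξ ψ)) τ := by
  have hw (σ : ℝ) (x : Space d) : HasDerivAt (fun σ : ℝ => planeWave (σ • ξ) x)
      (planeWave (σ • ξ) x * (Complex.I * (⟪ξ, x⟫_ℝ : ℝ))) σ := by
    have h1 : HasDerivAt (fun σ : ℝ => Complex.I * ((⟪σ • ξ, x⟫_ℝ : ℝ) : ℂ))
        (Complex.I * (⟪ξ, x⟫_ℝ : ℝ)) σ := by
      simpa [inner_smul_left] using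
        ((Complex.ofRealCLM.hasDerivAt (x := σ)).mul_const ((⟪ξ, x⟫_ℝ : ℝ) : ℂ)).const_mul Complex.I
    exact h1.cexp
  have h := hasDerivAt_integral_of_dominated_loc_of_deriv_le (μ := (volume : Measure (Space d)))
    (F := fun (σ : ℝ) x => planeWave (σ • ξ) x * ((starRingEnd ℂ) (φ x) * ψ x))
    (F' := fun (σ : ℝ) x => planeWave (σ • ξ) x * (Complex.I * (⟪ξ, x⟫_ℝ : ℝ)) *
      ((starRingEnd ℂ) (φ x) * ψ x)) (x₀ := τ) (s := Set.univ)
    (bound := fun x => ‖(starRingEnd ℂ) (φ x) * linearPosition ξ ψ x‖) Filter.univ_mem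
    (Filter.Eventually.of_forall fun σ => (continuous_planeWave _).aestronglyMeasurable.mul
      (integrable_conj_mul φ ψ).aestronglyMeasurable)
    ((integrable_conj_mul φ ψ).bdd_mul (continuous_planeWave _).aestronglyMeasurable
      (Filter.Eventually.of_forall fun x => (norm_planeWave _ x).le))
    (((continuous_planeWave _).mul (by fun_prop)).aestronglyMeasurable.mul
      (integrable_conj_mul φ ψ).aestronglyMeasurable)
    (Filter.Eventually.of_forall fun x σ _ => by
      rw [linearPosition_apply]
      simp only [norm_mul, norm_planeWave, Complex.norm_I]
      exact le_of_eq (by ring))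
    (integrable_conj_mul φ (linearPosition ξ ψ)).norm
    (Filter.Eventually.of_forall fun x σ _ => (hw σ x).mul_const _)
  simp only [waveInner_eq_integral]
  refine h.2.congr_deriv ?_
  rw [← integral_const_mul]
  refine integral_congr_ae (Filter.Eventually.of_forall fun x => ?_)
  simp only [linearPosition_apply]
  ring

theorem waveInner_linearPosition (ξ η : Space d) (φ ψ : 𝓢(Space d, ℂ)) :
    waveInner η φ (linearPosition ξ ψ) = ∑ j, ξ j * waveInner η φ (position d j ψ) := by
  have h : linearPosition ξ ψ = ∑ j, (ξ j : ℂ) • position d j ψ := by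
    simp [linearPosition, LinearMap.sum_apply]
  rw [h, waveInner, map_sum, map_sum, inner_sum]
  refine Finset.sum_congr rfl fun j _ => ?_
  rw [← waveInner_smul_right, waveInner]

end Phase


/-! ### The characteristic function of the thermal density. -/

section CharacteristicFunction

variable {d : ℕ}

theorem exists_succ_mul_pow_le {q : ℝ} (h0 : 0 ≤ q) (h1 : q < 1) :
    ∃ C : ℝ, ∀ n : ℕ, ((n : ℝ) + 1) * q ^ n ≤ C := by
  have h2 : Filter.Tendsto (fun n : ℕ => (n : ℝ) * q ^ n + q ^ n) Filter.atTop (nhds (0 + 0)) :=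
    (tendsto_self_mul_const_pow_of_lt_one h0 h1).add (tendsto_pow_atTop_nhds_zero_of_lt_one h0 h1)
  obtain ⟨C, hC⟩ := h2.bddAbove_range
  refine ⟨C, fun n => ?_⟩
  rw [add_mul, one_mul]
  exact hC ⟨n, rfl⟩

/-- Split `r = √r * √r`: one geometric factor absorbs `k j + 1`, the other remains summable. -/
theorem summable_pow_sum_mul {r : ℝ} (h0 : 0 ≤ r) (h1 : r < 1) (j : Fin d) :
    Summable fun k : Fin d → ℕ => r ^ (∑ i, k i) * ((k j : ℝ) + 1) := by
  have hq1 : √r < 1 := by rw [Real.sqrt_lt' one_pos]; simpa using h1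
  obtain ⟨C, hC⟩ := exists_succ_mul_pow_le (Real.sqrt_nonneg r) hq1
  refine ((summable_pow_sum d (Real.sqrt_nonneg r) hq1).mul_right C).of_nonneg_of_le
    (fun k => by positivity) fun k => ?_
  have h2 : r ^ (∑ i, k i) = √r ^ (∑ i, k i) * √r ^ (∑ i, k i) := by
    rw [← mul_pow, Real.mul_self_sqrt h0]
  have h3 : (k j : ℝ) ≤ ((∑ i, k i : ℕ) : ℝ) := by
    exact_mod_cast Finset.single_le_sum (f := k) (fun i _ => Nat.zero_le _) (Finset.mem_univ j)
  rw [h2, mul_assoc, mul_comm (√r ^ _) ((k j : ℝ) + 1)]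
  gcongr
  refine le_trans ?_ (hC (∑ i, k i))
  gcongr

theorem tsum_add_single {f : (Fin d → ℕ) → ℂ} {j : Fin d} (hf : ∀ k, k j = 0 → f k = 0) :
    ∑' k : Fin d → ℕ, f (k + Pi.single j 1) = ∑' k, f k := by
  refine Function.Injective.tsum_eq (g := fun k : Fin d → ℕ => k + Pi.single j 1)
    (add_left_injective _) fun k hk => ⟨k - Pi.single j 1, sub_single_add_single fun h => ?_⟩
  exact hk (hf k h)

theorem sum_add_single (k : Fin d → ℕ) (j : Fin d) :
    ∑ i, (k + Pi.single j 1 : Fin d → ℕ) i = (∑ i, k i) + 1 := by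
  simp [Finset.sum_add_distrib]

theorem sqrt_natCast_le (n : ℕ) : √(n : ℝ) ≤ n + 1 := by
  rw [Real.sqrt_le_left (by positivity)]
  nlinarith [(Nat.cast_nonneg n : (0 : ℝ) ≤ n)]

theorem sqrt_natCast_add_one_le (n : ℕ) : √((n : ℝ) + 1) ≤ n + 1 := by
  rw [Real.sqrt_le_left (by positivity)]
  nlinarith [(Nat.cast_nonneg n : (0 : ℝ) ≤ n)]

variable {s t : ℝ} {ω : ℂ} {u : (Fin d → ℕ) → 𝓢(Space d, ℂ)} {r : ℝ}

theorem IsLadder.norm_waveInner_le_one (h : IsLadder s t ω u) (ξ : Space d) (k l : Fin d → ℕ) :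
    ‖waveInner ξ (u k) (u l)‖ ≤ 1 := by
  simpa [h.norm_eq_one] using norm_waveInner_le ξ (u k) (u l)

theorem IsLadder.norm_waveInner_lowering_le (h : IsLadder s t ω u) (ξ : Space d) (j : Fin d)
    (k : Fin d → ℕ) : ‖waveInner ξ (u k) (lowering s t j (u k))‖ ≤ ‖ω‖ * (k j + 1) := by
  rw [h.lowering_eq, waveInner_smul_right, norm_mul, norm_mul, Complex.norm_real,
    Real.norm_of_nonneg (Real.sqrt_nonneg _)]
  calc _ ≤ ‖ω‖ * (k j + 1) * 1 := by
        gcongr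
        · exact sqrt_natCast_le _
        · exact h.norm_waveInner_le_one _ _ _
    _ = _ := mul_one _

theorem IsLadder.norm_waveInner_raising_le (h : IsLadder s t ω u) (ξ : Space d) (j : Fin d)
    (k : Fin d → ℕ) : ‖waveInner ξ (u k) (raising s t j (u k))‖ ≤ ‖ω‖ * (k j + 1) := by
  rw [h.raising_eq, waveInner_smul_right, norm_mul, norm_mul, Complex.norm_real,
    Real.norm_of_nonneg (Real.sqrt_nonneg _), RCLike.norm_conj]
  calc _ ≤ ‖ω‖ * (k j + 1) * 1 := by
        gcongr
        · exact sqrt_natCast_add_one_le _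
        · exact h.norm_waveInner_le_one _ _ _
    _ = _ := mul_one _

theorem two_mul_waveInner_position (ξ : Space d) (j : Fin d) (φ ψ : 𝓢(Space d, ℂ)) :
    2 * s * waveInner ξ φ (position d j ψ) =
      waveInner ξ φ (lowering s t j ψ) + waveInner ξ φ (raising s t j ψ) := by
  rw [← waveInner_add_right, lowering_add_raising, waveInner_smul_right]

theorem IsLadder.summable_waveInner (h : IsLadder s t ω u) (h0 : 0 ≤ r) (h1 : r < 1)
    (ξ : Space d) : Summable fun k => (r : ℂ) ^ (∑ i, k i) * waveInner ξ (u k) (u k) := by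
  refine Summable.of_norm_bounded (summable_pow_sum d h0 h1) fun k => ?_
  rw [norm_mul, norm_pow, Complex.norm_real, Real.norm_of_nonneg h0]
  exact mul_le_of_le_one_right (by positivity) (h.norm_waveInner_le_one _ _ _)

/-- A concrete form of cyclicity of the trace. Shifting `k` by a unit vector turns `⟨u k, W a u k⟩`
into `⟨a† u k, W u k⟩`, `W` the plane wave, and costs a factor `r`; moving `a†` back as `a` adds the
commutator. The sum `A` thus satisfies `A = r (A + t i ξ_j F)`. -/
theorem IsLadder.tsum_lowering (h : IsLadder s t ω u) (h0 : 0 ≤ r) (h1 : r < 1) (ξ : Space d)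
    (j : Fin d) :
    Summable (fun k => (r : ℂ) ^ (∑ i, k i) * waveInner ξ (u k) (lowering s t j (u k))) ∧
    (1 - r) * ∑' k, (r : ℂ) ^ (∑ i, k i) * waveInner ξ (u k) (lowering s t j (u k)) =
      r * (t * (Complex.I * ξ j)) * ∑' k, (r : ℂ) ^ (∑ i, k i) * waveInner ξ (u k) (u k) := by
  have hs : Summable fun k =>
      (r : ℂ) ^ (∑ i, k i) * waveInner ξ (u k) (lowering s t j (u k)) := by
    refine Summable.of_norm_bounded ((summable_pow_sum_mul h0 h1 j).mul_left ‖ω‖) fun k => ?_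
    rw [norm_mul, norm_pow, Complex.norm_real, Real.norm_of_nonneg h0, mul_left_comm]
    gcongr
    exact h.norm_waveInner_lowering_le ξ j k
  refine ⟨hs, ?_⟩
  have hshift (k : Fin d → ℕ) :
      waveInner ξ (u (k + Pi.single j 1)) (lowering s t j (u (k + Pi.single j 1))) =
        waveInner ξ (raising s t j (u k)) (u k) := by
    rw [h.lowering_eq, h.raising_eq, waveInner_smul_right, waveInner_smul_left,
      add_single_sub_single]
    simp
  have h2 := tsum_add_single (j := j)
    (f := fun k => (r : ℂ) ^ (∑ i, k i) * waveInner ξ (u k) (lowering s t j (u k)))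
    (fun k hk => by rw [h.lowering_eq, waveInner_smul_right, hk]; simp)
  simp only [hshift, sum_add_single, waveInner_raising_left] at h2
  have h3 : ∑' k : Fin d → ℕ, (r : ℂ) ^ ((∑ i, k i) + 1) *
        (waveInner ξ (u k) (lowering s t j (u k)) +
          t * (Complex.I * ξ j) * waveInner ξ (u k) (u k)) =
      r * (∑' k, (r : ℂ) ^ (∑ i, k i) * waveInner ξ (u k) (lowering s t j (u k))) +
      r * (t * (Complex.I * ξ j)) *
        ∑' k, (r : ℂ) ^ (∑ i, k i) * waveInner ξ (u k) (u k) := by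
    rw [← tsum_mul_left, ← tsum_mul_left, ← Summable.tsum_add (hs.mul_left _)
      ((h.summable_waveInner h0 h1 ξ).mul_left _)]
    refine tsum_congr fun k => ?_
    ring
  rw [h3] at h2
  linear_combination -h2

/-- The same shift run the other way: the sum `P` satisfies `r P = P - t i ξ_j F`. -/
theorem IsLadder.tsum_raising (h : IsLadder s t ω u) (h0 : 0 ≤ r) (h1 : r < 1) (ξ : Space d)
    (j : Fin d) :
    Summable (fun k => (r : ℂ) ^ (∑ i, k i) * waveInner ξ (u k) (raising s t j (u k))) ∧
    (1 - r) * ∑' k, (r : ℂ) ^ (∑ i, k i) * waveInner ξ (u k) (raising s t j (u k)) =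
      (t * (Complex.I * ξ j)) * ∑' k, (r : ℂ) ^ (∑ i, k i) * waveInner ξ (u k) (u k) := by
  have hs : Summable fun k =>
      (r : ℂ) ^ (∑ i, k i) * waveInner ξ (u k) (raising s t j (u k)) := by
    refine Summable.of_norm_bounded ((summable_pow_sum_mul h0 h1 j).mul_left ‖ω‖) fun k => ?_
    rw [norm_mul, norm_pow, Complex.norm_real, Real.norm_of_nonneg h0, mul_left_comm]
    gcongr
    exact h.norm_waveInner_raising_le ξ j k
  refine ⟨hs, ?_⟩
  have hshift (k : Fin d → ℕ) :
      waveInner ξ (lowering s t j (u (k + Pi.single j 1))) (u (k + Pi.single j 1)) =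
        waveInner ξ (u k) (raising s t j (u k)) := by
    rw [h.lowering_eq, h.raising_eq, waveInner_smul_right, waveInner_smul_left,
      add_single_sub_single]
    simp
  have h2 := tsum_add_single (j := j)
    (f := fun k => (r : ℂ) ^ (∑ i, k i) * waveInner ξ (lowering s t j (u k)) (u k))
    (fun k hk => by rw [h.lowering_eq, waveInner_smul_left, hk]; simp)
  simp only [hshift, sum_add_single] at h2
  simp only [waveInner_lowering_left, mul_sub] at h2
  rw [Summable.tsum_sub hs (((h.summable_waveInner h0 h1 ξ).mul_left
    (t * (Complex.I * ξ j))).congr fun k => by ring)] at h2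
  have h3 : ∑' k : Fin d → ℕ, (r : ℂ) ^ ((∑ i, k i) + 1) *
        waveInner ξ (u k) (raising s t j (u k)) =
      r * ∑' k, (r : ℂ) ^ (∑ i, k i) * waveInner ξ (u k) (raising s t j (u k)) := by
    rw [← tsum_mul_left]
    exact tsum_congr fun k => by ring
  have h4 : ∑' k : Fin d → ℕ, (r : ℂ) ^ (∑ i, k i) *
        (t * (Complex.I * ξ j) * waveInner ξ (u k) (u k)) =
      (t * (Complex.I * ξ j)) * ∑' k, (r : ℂ) ^ (∑ i, k i) * waveInner ξ (u k) (u k) := by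
    rw [← tsum_mul_left]
    exact tsum_congr fun k => by ring
  rw [h3, h4] at h2
  linear_combination -h2

theorem IsLadder.hasSum_position (h : IsLadder s t ω u) (hs : 0 < s) (h0 : 0 ≤ r) (h1 : r < 1)
    (ξ : Space d) (j : Fin d) :
    HasSum (fun k => (r : ℂ) ^ (∑ i, k i) * waveInner ξ (u k) (position d j (u k)))
      ((t / (2 * s) * ((1 + r) / (1 - r)) : ℝ) * (Complex.I * ξ j) *
        ∑' k, (r : ℂ) ^ (∑ i, k i) * waveInner ξ (u k) (u k)) := by
  obtain ⟨hA, hA'⟩ := h.tsum_lowering h0 h1 ξ j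
  obtain ⟨hP, hP'⟩ := h.tsum_raising h0 h1 ξ j
  have hs' : (s : ℂ) ≠ 0 := by exact_mod_cast hs.ne'
  have hr' : (1 - r : ℂ) ≠ 0 := by exact_mod_cast (sub_pos.mpr h1).ne'
  have hsum := (hA.hasSum.add hP.hasSum).mul_left ((2 * s : ℂ)⁻¹)
  have hval : ((t / (2 * s) * ((1 + r) / (1 - r)) : ℝ) * (Complex.I * ξ j) *
      ∑' k, (r : ℂ) ^ (∑ i, k i) * waveInner ξ (u k) (u k) : ℂ) = (2 * s : ℂ)⁻¹ *
      (∑' k, (r : ℂ) ^ (∑ i, k i) * waveInner ξ (u k) (lowering s t j (u k)) +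
        ∑' k, (r : ℂ) ^ (∑ i, k i) * waveInner ξ (u k) (raising s t j (u k))) := by
    push_cast
    field_simp
    linear_combination -hA' - hP'
  rw [hval]
  refine (congrArg (HasSum · _) (funext fun k => ?_)).mp hsum
  rw [← mul_add, ← two_mul_waveInner_position]
  field_simp

/-- Along the ray `τ ξ`, the identity for `x_j` becomes `F' = -γ |ξ|² τ F`, with `F 0` the total
mass because the `u k` are normalized. -/
theorem IsLadder.tsum_waveInner (h : IsLadder s t ω u) (hs : 0 < s) (h0 : 0 ≤ r) (h1 : r < 1)
    (ξ : Space d) :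
    ∑' k, (r : ℂ) ^ (∑ i, k i) * waveInner ξ (u k) (u k) =
      (∑' k : Fin d → ℕ, r ^ (∑ i, k i) : ℝ) *
        Real.exp (-(t / (2 * s) * ((1 + r) / (1 - r)) / 2 * ‖ξ‖ ^ 2)) := by
  set γ : ℝ := t / (2 * s) * ((1 + r) / (1 - r)) with hγ
  set F : ℝ → ℂ := fun τ => ∑' k, (r : ℂ) ^ (∑ i, k i) * waveInner (τ • ξ) (u k) (u k) with hF
  have hpos (τ : ℝ) (j : Fin d) := h.hasSum_position hs h0 h1 (τ • ξ) j
  -- A bound independent of `η`, growing only linearly in `k`, permits differentiating the series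
  -- term by term.
  have hbound (η : Space d) (k : Fin d → ℕ) : ‖waveInner η (u k) (linearPosition ξ (u k))‖ ≤
      ∑ j, ‖ξ j‖ * (‖ω‖ / s * (k j + 1)) := by
    rw [waveInner_linearPosition]
    refine (norm_sum_le _ _).trans (Finset.sum_le_sum fun j _ => ?_)
    rw [norm_mul, Complex.norm_real]
    gcongr
    have e1 := congrArg norm (two_mul_waveInner_position (s := s) (t := t) η j (u k) (u k))
    rw [norm_mul, norm_mul, Complex.norm_real, Real.norm_of_nonneg hs.le, Complex.norm_two] at e1
    have e2 := (e1.le.trans (norm_add_le _ _)).trans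
      (add_le_add (h.norm_waveInner_lowering_le η j k) (h.norm_waveInner_raising_le η j k))
    rw [div_mul_eq_mul_div, le_div_iff₀ hs]
    linarith
  have hderiv (τ : ℝ) : HasDerivAt F (-(γ * ‖ξ‖ ^ 2 * τ : ℝ) * F τ) τ := by
    have h2 := hasDerivAt_tsum
      (g := fun (k : Fin d → ℕ) (τ : ℝ) => (r : ℂ) ^ (∑ i, k i) * waveInner (τ • ξ) (u k) (u k))
      (g' := fun k τ => (r : ℂ) ^ (∑ i, k i) *
        (Complex.I * waveInner (τ • ξ) (u k) (linearPosition ξ (u k))))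
      (u := fun k => ∑ j, ‖ξ j‖ * (‖ω‖ / s) * (r ^ (∑ i, k i) * (k j + 1))) (y₀ := 0)
      (summable_sum fun j _ => (summable_pow_sum_mul h0 h1 j).mul_left _)
      (fun k τ => (hasDerivAt_waveInner ξ (u k) (u k) τ).const_mul _)
      (fun k τ => by
        rw [norm_mul, norm_mul, norm_pow, Complex.norm_I, one_mul, Complex.norm_real,
          Real.norm_of_nonneg h0]
        refine (mul_le_mul_of_nonneg_left (hbound _ k) (by positivity)).trans (le_of_eq ?_)
        rw [Finset.mul_sum]
        exact Finset.sum_congr rfl fun j _ => by ring)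
      (h.summable_waveInner h0 h1 _) τ
    refine h2.congr_deriv ?_
    have h3 : HasSum (fun k => (r : ℂ) ^ (∑ i, k i) *
        (Complex.I * waveInner (τ • ξ) (u k) (linearPosition ξ (u k))))
        (∑ j, Complex.I * ξ j * (γ * (Complex.I * (τ • ξ) j) * F τ)) := by
      refine (congrArg (HasSum · _) (funext fun k => ?_)).mp
        (hasSum_sum fun j (_ : j ∈ Finset.univ) => (hpos τ j).mul_left (Complex.I * ξ j))
      rw [waveInner_linearPosition, Finset.mul_sum, Finset.mul_sum]
      exact Finset.sum_congr rfl fun j _ => by ring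
    rw [h3.tsum_eq, EuclideanSpace.norm_sq_eq]
    push_cast
    rw [Finset.mul_sum, Finset.sum_mul, ← Finset.sum_neg_distrib, Finset.sum_mul]
    refine Finset.sum_congr rfl fun j _ => ?_
    rw [Real.norm_eq_abs, ← Complex.ofReal_pow, sq_abs]
    simp only [PiLp.smul_apply, smul_eq_mul]
    push_cast
    linear_combination (γ * τ * ξ j ^ 2 * F τ : ℂ) * Complex.I_sq
  -- Integrating factor: `F` times the inverse Gaussian has zero derivative; its values at `0` and
  -- `1` are compared.
  have hconst (τ : ℝ) : HasDerivAt
      (fun τ : ℝ => F τ * Complex.exp ((γ / 2 * ‖ξ‖ ^ 2 * τ ^ 2 : ℝ) : ℂ)) 0 τ := by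
    have h4 : HasDerivAt (fun τ : ℝ => γ / 2 * ‖ξ‖ ^ 2 * τ ^ 2) (γ * ‖ξ‖ ^ 2 * τ) τ :=
      ((hasDerivAt_pow 2 τ).const_mul (γ / 2 * ‖ξ‖ ^ 2)).congr_deriv (by push_cast; ring)
    refine ((hderiv τ).mul h4.ofReal_comp.cexp).congr_deriv ?_
    push_cast
    ring
  have heq := is_const_of_deriv_eq_zero (fun τ => (hconst τ).differentiableAt)
    (fun τ => (hconst τ).deriv) 1 0
  have hF0 : F 0 = (∑' k : Fin d → ℕ, r ^ (∑ i, k i) : ℝ) := by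
    rw [hF, Complex.ofReal_tsum]
    refine tsum_congr fun k => ?_
    have : waveInner ((0 : ℝ) • ξ) (u k) (u k) = 1 := by
      have h5 : mulPlaneWave ((0 : ℝ) • ξ) (u k) = u k := by
        ext x
        simp [mulPlaneWave_apply, planeWave]
      rw [waveInner, h5, inner_self_eq_norm_sq_to_K, h.norm_eq_one]
      simp
    rw [this, mul_one, Complex.ofReal_pow]
  have hF1 : F 1 = ∑' k, (r : ℂ) ^ (∑ i, k i) * waveInner ξ (u k) (u k) := by
    simp only [hF, one_smul]
  rw [← hF0, ← hF1, Complex.ofReal_exp]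
  simp only [one_pow, mul_one, zero_pow two_ne_zero, mul_zero, Complex.ofReal_zero,
    Complex.exp_zero] at heq
  rw [← heq, mul_assoc, ← Complex.exp_add]
  simp

end CharacteristicFunction


/-! ### The thermal density is Gaussian; its moments. -/

section Density

variable {d : ℕ}

theorem lintegral_withDensity_ofReal {g f : Space d → ℝ} (hg : Measurable g) (hg0 : ∀ x, 0 ≤ g x)
    (hf : Measurable f) :
    ∫⁻ x, ENNReal.ofReal (f x) ∂(volume.withDensity fun x => ENNReal.ofReal (g x)) =
      ∫⁻ x, ENNReal.ofReal (g x * f x) := by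
  rw [lintegral_withDensity_eq_lintegral_mul _ hg.ennreal_ofReal hf.ennreal_ofReal]
  refine lintegral_congr fun x => ?_
  rw [Pi.mul_apply, ENNReal.ofReal_mul (hg0 x)]

theorem integral_withDensity_ofReal {g : Space d → ℝ} (hg : Measurable g) (hg0 : ∀ x, 0 ≤ g x)
    (f : Space d → ℂ) :
    ∫ x, f x ∂(volume.withDensity fun x => ENNReal.ofReal (g x)) = ∫ x, (g x : ℂ) * f x := by
  rw [integral_withDensity_eq_integral_toReal_smul hg.ennreal_ofReal
    (Filter.Eventually.of_forall fun _ => ENNReal.ofReal_lt_top)]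
  refine integral_congr_ae (Filter.Eventually.of_forall fun x => ?_)
  simp only [ENNReal.toReal_ofReal (hg0 x), Complex.real_smul]

theorem integral_norm_rpow_mul_exp_neg (hd : 1 ≤ d) {κ n : ℝ} (hκ : 0 < κ) (hn : -(d : ℝ) < n) :
    Integrable (fun x : Space d => ‖x‖ ^ n * Real.exp (-κ * ‖x‖ ^ 2)) ∧
    ∫ x : Space d, ‖x‖ ^ n * Real.exp (-κ * ‖x‖ ^ 2) =
      Real.Gamma (((d : ℝ) + n) / 2) / Real.Gamma ((d : ℝ) / 2) * κ ^ (-n / 2) *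
        (Real.pi / κ) ^ ((d : ℝ) / 2) := by
  have : NeZero d := ⟨by omega⟩
  have hcast : ((d - 1 : ℕ) : ℝ) = d - 1 := by rw [Nat.cast_sub hd]; simp
  have hd0 : (0 : ℝ) < d := by exact_mod_cast hd
  have hrad (m y : ℝ) (hy : y ∈ Set.Ioi (0 : ℝ)) :
      y ^ (d - 1) • (y ^ m * Real.exp (-κ * y ^ 2)) =
        y ^ ((d : ℝ) - 1 + m) * Real.exp (-κ * y ^ (2 : ℝ)) := by
    rw [Real.rpow_add hy, ← hcast, Real.rpow_natCast, Real.rpow_two, smul_eq_mul, mul_assoc]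
  have hval (m : ℝ) (hm : -(d : ℝ) < m) :
      ∫ x : Space d, ‖x‖ ^ m * Real.exp (-κ * ‖x‖ ^ 2) =
        d * volume.real (Metric.ball (0 : Space d) 1) *
          (κ ^ (-((d : ℝ) + m) / 2) * (1 / 2) * Real.Gamma (((d : ℝ) + m) / 2)) := by
    rw [integral_fun_norm_addHaar volume fun y => y ^ m * Real.exp (-κ * y ^ 2),
      finrank_euclideanSpace_fin, setIntegral_congr_fun measurableSet_Ioi (hrad m),
      integral_rpow_mul_exp_neg_mul_rpow two_pos (by linarith) hκ, nsmul_eq_mul, smul_eq_mul,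
      mul_assoc]
    ring_nf
  constructor
  · rw [integrable_fun_norm_addHaar volume (f := fun y => y ^ n * Real.exp (-κ * y ^ 2)),
      finrank_euclideanSpace_fin, integrableOn_congr_fun (hrad n) measurableSet_Ioi]
    exact integrableOn_rpow_mul_exp_neg_mul_rpow (by linarith) two_pos hκ
  -- Comparing the case of exponent `0` with the known Gaussian integral eliminates the volume of
  -- the unit ball.
  · have h0 := hval 0 (by linarith)
    have h1 := GaussianFourier.integral_rexp_neg_mul_sq_norm (V := Space d) hκ
    rw [finrank_euclideanSpace_fin] at h1
    simp only [Real.rpow_zero, one_mul, add_zero] at h0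
    rw [h1] at h0
    rw [hval n hn, h0, show -((d : ℝ) + n) / 2 = -n / 2 + -d / 2 by ring, Real.rpow_add hκ]
    have hΓ : Real.Gamma ((d : ℝ) / 2) ≠ 0 := (Real.Gamma_pos_of_pos (by positivity)).ne'
    field_simp

/-- The density `∑ₖ r^|k| |uₖ|²` of a ladder family, as a measure. -/
def thermalMeasure (r : ℝ) (u : (Fin d → ℕ) → 𝓢(Space d, ℂ)) : Measure (Space d) :=
  Measure.sum fun k => volume.withDensity fun x =>
    ENNReal.ofReal (r ^ (∑ i, k i) * ‖u k x‖ ^ 2)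

/-- The multiple of the Gaussian measure with density proportional to `exp (-κ |x|²)` and with
total mass `Z`. -/
def gaussianMeasure (d : ℕ) (Z κ : ℝ) : Measure (Space d) :=
  volume.withDensity fun x =>
    ENNReal.ofReal (Z * (Real.pi / κ) ^ (-(d : ℝ) / 2) * Real.exp (-κ * ‖x‖ ^ 2))

theorem measurable_ladder_density (r : ℝ) (φ : 𝓢(Space d, ℂ)) (m : ℕ) :
    Measurable fun x => r ^ m * ‖φ x‖ ^ 2 :=
  (continuous_const.mul (φ.continuous.norm.pow 2)).measurable

theorem charFun_gaussianMeasure {Z κ : ℝ} (hZ : 0 ≤ Z) (hκ : 0 < κ) (ξ : Space d) :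
    charFun (gaussianMeasure d Z κ) ξ = Z * Real.exp (-(‖ξ‖ ^ 2 / (4 * κ))) := by
  have hpos : 0 < Real.pi / κ := div_pos Real.pi_pos hκ
  rw [charFun_apply, gaussianMeasure, integral_withDensity_ofReal (by fun_prop)
    (fun x => by positivity)]
  have h := GaussianFourier.integral_cexp_neg_mul_sq_norm_add (V := Space d) (b := (κ : ℂ))
    (by simpa using hκ) Complex.I ξ
  have h1 (x : Space d) :
      ((Z * (Real.pi / κ) ^ (-(d : ℝ) / 2) * Real.exp (-κ * ‖x‖ ^ 2) : ℝ) : ℂ) *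
        Complex.exp ((⟪x, ξ⟫_ℝ : ℝ) * Complex.I) =
      ((Z * (Real.pi / κ) ^ (-(d : ℝ) / 2) : ℝ) : ℂ) *
        Complex.exp (-(κ : ℂ) * (‖x‖ : ℂ) ^ 2 + Complex.I * (⟪ξ, x⟫_ℝ : ℝ)) := by
    rw [Complex.exp_add, Complex.ofReal_mul, Complex.ofReal_exp, real_inner_comm]
    push_cast
    ring_nf
  simp only [h1]
  rw [integral_const_mul, h, finrank_euclideanSpace_fin]
  have h2 : ((Real.pi : ℂ) / κ) ^ ((d : ℂ) / 2) = (((Real.pi / κ) ^ ((d : ℝ) / 2) : ℝ) : ℂ) := by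
    rw [Complex.ofReal_cpow hpos.le]
    push_cast
    rfl
  have h3 : (Real.pi / κ) ^ (-(d : ℝ) / 2) * (Real.pi / κ) ^ ((d : ℝ) / 2) = 1 := by
    rw [← Real.rpow_add hpos]
    ring_nf
    exact Real.rpow_zero _
  have h3' : (((Real.pi / κ) ^ (-(d : ℝ) / 2) : ℝ) : ℂ) *
      (((Real.pi / κ) ^ ((d : ℝ) / 2) : ℝ) : ℂ) = 1 := by exact_mod_cast h3
  rw [h2, Complex.ofReal_mul, ← mul_assoc, mul_assoc (Z : ℂ), h3', mul_one, Complex.I_sq,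
    Complex.ofReal_exp]
  congr 2
  push_cast
  ring

theorem isFiniteMeasure_gaussianMeasure (Z : ℝ) {κ : ℝ} (hκ : 0 < κ) :
    IsFiniteMeasure (gaussianMeasure d Z κ) := by
  refine isFiniteMeasure_withDensity_ofReal (Integrable.const_mul ?_ _).2
  refine ((realGaussian d hκ).integrable (μ := volume)).congr
    (Filter.Eventually.of_forall fun x => ?_)
  change Real.exp (-(κ * ‖x‖ ^ 2)) = Real.exp (-κ * ‖x‖ ^ 2)
  rw [neg_mul]

variable {s t : ℝ} {ω : ℂ} {u : (Fin d → ℕ) → 𝓢(Space d, ℂ)} {r : ℝ}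

theorem integrable_norm_sq (φ : 𝓢(Space d, ℂ)) : Integrable fun x => ‖φ x‖ ^ 2 :=
  (memLp_two_iff_integrable_sq_norm φ.continuous.aestronglyMeasurable).mp (φ.memLp 2)

theorem integral_norm_sq (φ : 𝓢(Space d, ℂ)) :
    ∫ x, ‖φ x‖ ^ 2 = ‖schwartzIncl d φ‖ ^ 2 := by
  have h := inner_schwartzIncl φ φ
  rw [inner_self_eq_norm_sq_to_K] at h
  have h1 : ∫ x, (starRingEnd ℂ) (φ x) * φ x = ((∫ x, ‖φ x‖ ^ 2 : ℝ) : ℂ) := by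
    rw [← integral_complex_ofReal]
    refine integral_congr_ae (Filter.Eventually.of_forall fun x => ?_)
    simp only [Complex.conj_mul', Complex.ofReal_pow]
  rw [h1] at h
  simp only [Complex.coe_algebraMap] at h
  exact_mod_cast h.symm

theorem lintegral_thermalMeasure (h0 : 0 ≤ r) {f : Space d → ℝ} (hf : Measurable f) :
    ∫⁻ x, ENNReal.ofReal (f x) ∂(thermalMeasure r u) =
      ∑' k, ∫⁻ x, ENNReal.ofReal (r ^ (∑ i, k i) * ‖u k x‖ ^ 2 * f x) := by
  rw [thermalMeasure, lintegral_sum_measure]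
  exact tsum_congr fun k => lintegral_withDensity_ofReal (measurable_ladder_density _ _ _)
    (fun x => by positivity) hf

theorem IsLadder.isFiniteMeasure_thermalMeasure (h : IsLadder s t ω u) (h0 : 0 ≤ r)
    (h1 : r < 1) : IsFiniteMeasure (thermalMeasure r u) := by
  constructor
  have h2 := lintegral_thermalMeasure (u := u) h0 (f := fun _ => 1) measurable_const
  simp only [ENNReal.ofReal_one, lintegral_one, mul_one] at h2
  rw [h2]
  have h3 (k : Fin d → ℕ) : ∫⁻ x, ENNReal.ofReal (r ^ (∑ i, k i) * ‖u k x‖ ^ 2) =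
      ENNReal.ofReal (r ^ (∑ i, k i)) := by
    rw [← ofReal_integral_eq_lintegral_ofReal ((integrable_norm_sq (u k)).const_mul _)
      (Filter.Eventually.of_forall fun x => by positivity), integral_const_mul, integral_norm_sq,
      h.norm_eq_one, one_pow, mul_one]
  simp only [h3]
  rw [← ENNReal.ofReal_tsum_of_nonneg (fun k => by positivity) (summable_pow_sum d h0 h1)]
  exact ENNReal.ofReal_lt_top

theorem IsLadder.charFun_thermalMeasure (h : IsLadder s t ω u) (h0 : 0 ≤ r) (h1 : r < 1)
    (ξ : Space d) :
    charFun (thermalMeasure r u) ξ =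
      ∑' k, (r : ℂ) ^ (∑ i, k i) * waveInner ξ (u k) (u k) := by
  have := h.isFiniteMeasure_thermalMeasure h0 h1
  have hint : Integrable (fun x => Complex.exp ((⟪x, ξ⟫_ℝ : ℝ) * Complex.I))
      (thermalMeasure r u) := by
    refine Integrable.of_bound (Continuous.aestronglyMeasurable (by fun_prop)) 1
      (Filter.Eventually.of_forall fun x => ?_)
    rw [Complex.norm_exp_ofReal_mul_I]
  rw [charFun_apply, thermalMeasure, integral_sum_measure hint]
  refine tsum_congr fun k => ?_
  rw [integral_withDensity_ofReal (measurable_ladder_density _ _ _) (fun x => by positivity),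
    waveInner_eq_integral, ← integral_const_mul]
  refine integral_congr_ae (Filter.Eventually.of_forall fun x => ?_)
  simp only [Complex.conj_mul', planeWave, real_inner_comm ξ x, mul_comm Complex.I]
  push_cast
  ring

/-- Equality of characteristic functions of finite measures: variance `γ` in each direction
corresponds to the rate `1 / (2 γ) = s / t * (1 - r) / (1 + r)`. -/
theorem IsLadder.thermalMeasure_eq (h : IsLadder s t ω u) (hs : 0 < s) (ht : 0 < t)
    (h0 : 0 ≤ r) (h1 : r < 1) :
    thermalMeasure r u = gaussianMeasure d (∑' k : Fin d → ℕ, r ^ (∑ i, k i))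
      (s / t * ((1 - r) / (1 + r))) := by
  have hr : 0 < 1 - r := sub_pos.mpr h1
  have hκ : 0 < s / t * ((1 - r) / (1 + r)) := by positivity
  have := h.isFiniteMeasure_thermalMeasure h0 h1
  have := isFiniteMeasure_gaussianMeasure (d := d) (∑' k : Fin d → ℕ, r ^ (∑ i, k i)) hκ
  refine Measure.ext_of_charFun (funext fun ξ => ?_)
  rw [h.charFun_thermalMeasure h0 h1, h.tsum_waveInner hs h0 h1,
    charFun_gaussianMeasure (tsum_nonneg fun k => by positivity) hκ]
  congr 3
  field_simp
  ring

/-- All terms are nonnegative, so sum and integral are exchanged as `lintegral`s without any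
hypothesis. Finiteness of the total, a Gaussian moment, then yields integrability of each term and
convergence in `ℝ`. -/
theorem IsLadder.hasSum_integral_norm_rpow (hd : 1 ≤ d) (h : IsLadder s t ω u) (hs : 0 < s)
    (ht : 0 < t) (h0 : 0 < r) (h1 : r < 1) {n : ℝ} (hn : -(d : ℝ) < n) :
    (∀ k, Integrable fun x => ‖x‖ ^ n * ‖u k x‖ ^ 2) ∧
    HasSum (fun k => r ^ (∑ i, k i) * ∫ x, ‖x‖ ^ n * ‖u k x‖ ^ 2)
      ((∑' k : Fin d → ℕ, r ^ (∑ i, k i)) *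
        (Real.Gamma (((d : ℝ) + n) / 2) / Real.Gamma ((d : ℝ) / 2) *
          (s / t * ((1 - r) / (1 + r))) ^ (-n / 2))) := by
  have hr : 0 < 1 - r := sub_pos.mpr h1
  set κ := s / t * ((1 - r) / (1 + r)) with hκdef
  set Z := ∑' k : Fin d → ℕ, r ^ (∑ i, k i) with hZdef
  have hκ : 0 < κ := by positivity
  have hZ : 0 ≤ Z := tsum_nonneg fun k => by positivity
  have hpos : 0 < Real.pi / κ := div_pos Real.pi_pos hκ
  have hmeas : Measurable fun x : Space d => ‖x‖ ^ n := measurable_norm.pow_const n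
  obtain ⟨hint, hval⟩ := integral_norm_rpow_mul_exp_neg hd hκ hn
  set M := Real.Gamma (((d : ℝ) + n) / 2) / Real.Gamma ((d : ℝ) / 2) * κ ^ (-n / 2) with hM
  have hM0 : 0 ≤ M := by
    have hd0 : (0 : ℝ) < d := by exact_mod_cast hd
    have := Real.Gamma_pos_of_pos (show 0 < ((d : ℝ) + n) / 2 by linarith)
    have := Real.Gamma_pos_of_pos (show 0 < (d : ℝ) / 2 by linarith)
    positivity
  have hlint : ∑' k, ∫⁻ x, ENNReal.ofReal (r ^ (∑ i, k i) * ‖u k x‖ ^ 2 * ‖x‖ ^ n) =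
      ENNReal.ofReal (Z * M) := by
    rw [← lintegral_thermalMeasure h0.le hmeas, h.thermalMeasure_eq hs ht h0.le h1,
      gaussianMeasure, lintegral_withDensity_ofReal (by fun_prop) (fun x => by positivity) hmeas,
      ← ofReal_integral_eq_lintegral_ofReal]
    · congr 1
      have e (x : Space d) : Z * (Real.pi / κ) ^ (-(d : ℝ) / 2) * Real.exp (-κ * ‖x‖ ^ 2) *
          ‖x‖ ^ n = Z * (Real.pi / κ) ^ (-(d : ℝ) / 2) *
            (‖x‖ ^ n * Real.exp (-κ * ‖x‖ ^ 2)) := by ring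
      have h3 : (Real.pi / κ) ^ (-(d : ℝ) / 2) * (Real.pi / κ) ^ ((d : ℝ) / 2) = 1 := by
        rw [← Real.rpow_add hpos]
        ring_nf
        exact Real.rpow_zero _
      change ∫ x : Space d, Z * (Real.pi / κ) ^ (-(d : ℝ) / 2) * Real.exp (-κ * ‖x‖ ^ 2) *
        ‖x‖ ^ n = Z * M
      simp only [e]
      rw [integral_const_mul, hval]
      linear_combination (Z * M) * h3
    · refine (hint.const_mul (Z * (Real.pi / κ) ^ (-(d : ℝ) / 2))).congr
        (Filter.Eventually.of_forall fun x => ?_)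
      change _ = Z * (Real.pi / κ) ^ (-(d : ℝ) / 2) * Real.exp (-κ * ‖x‖ ^ 2) * ‖x‖ ^ n
      ring
    · exact Filter.Eventually.of_forall fun x => by positivity
  have hne : ∑' k, ∫⁻ x, ENNReal.ofReal (r ^ (∑ i, k i) * ‖u k x‖ ^ 2 * ‖x‖ ^ n) ≠ ⊤ := by
    rw [hlint]
    exact ENNReal.ofReal_ne_top
  have hnn (k : Fin d → ℕ) :
      0 ≤ᵐ[volume] fun x => r ^ (∑ i, k i) * ‖u k x‖ ^ 2 * ‖x‖ ^ n :=
    Filter.Eventually.of_forall fun x => by positivity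
  have hintk (k : Fin d → ℕ) :
      Integrable fun x => r ^ (∑ i, k i) * ‖u k x‖ ^ 2 * ‖x‖ ^ n := by
    refine (lintegral_ofReal_ne_top_iff_integrable ?_ (hnn k)).mp
      (ENNReal.ne_top_of_tsum_ne_top hne k)
    exact ((measurable_ladder_density _ _ _).mul hmeas).aestronglyMeasurable
  have hk (k : Fin d → ℕ) :
      (∫⁻ x, ENNReal.ofReal (r ^ (∑ i, k i) * ‖u k x‖ ^ 2 * ‖x‖ ^ n)).toReal =
        r ^ (∑ i, k i) * ∫ x, ‖x‖ ^ n * ‖u k x‖ ^ 2 := by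
    rw [← ofReal_integral_eq_lintegral_ofReal (hintk k) (hnn k),
      ENNReal.toReal_ofReal (integral_nonneg fun x => by positivity), ← integral_const_mul]
    refine integral_congr_ae (Filter.Eventually.of_forall fun x => ?_)
    ring
  constructor
  · intro k
    have hrk : r ^ (∑ i, k i) ≠ 0 := (pow_pos h0 _).ne'
    refine ((hintk k).const_mul (r ^ (∑ i, k i))⁻¹).congr
      (Filter.Eventually.of_forall fun x => ?_)
    field_simp
  · have hsum := ENNReal.hasSum_toReal hne
    rw [← ENNReal.tsum_toReal_eq (ENNReal.ne_top_of_tsum_ne_top hne), hlint,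
      ENNReal.toReal_ofReal (mul_nonneg hZ hM0)] at hsum
    simpa only [hk] using hsum

end Density


/-! ### Closedness of multiplication operators and Fourier multipliers. -/

section Multiplication

variable {d : ℕ}

theorem mem_graph_mulOp_iff {w : Space d → ℝ} {f g : L2 d} :
    (f, g) ∈ (mulOp d w).graph ↔ g =ᵐ[volume] fun x => (w x : ℂ) * f x := by
  rw [LinearPMap.mem_graph_iff]
  constructor
  · rintro ⟨y, rfl, hy⟩
    change MemLp.toLp _ y.2 = g at hy
    rw [← hy]
    exact MemLp.coeFn_toLp _
  · intro h
    have hf : MemLp (fun x => (w x : ℂ) * f x) 2 volume := (Lp.memLp g).ae_eq h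
    refine ⟨⟨f, hf⟩, rfl, ?_⟩
    apply Lp.ext
    exact (MemLp.coeFn_toLp hf).trans h.symm

/-- Convergence in `L²` gives almost everywhere convergence along a subsequence; extracting twice
makes arguments and images converge together, and the pointwise relation passes to the limit. -/
theorem isClosed_mulOp (w : Space d → ℝ) : (mulOp d w).IsClosed := by
  refine IsSeqClosed.isClosed fun p q hp hpq => ?_
  obtain ⟨f, g⟩ := q
  have hf : Filter.Tendsto (fun n => (p n).1) Filter.atTop (nhds f) :=
    (continuous_fst.tendsto _).comp hpq
  have hg : Filter.Tendsto (fun n => (p n).2) Filter.atTop (nhds g) :=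
    (continuous_snd.tendsto _).comp hpq
  obtain ⟨ns, hns, hfa⟩ := (tendstoInMeasure_of_tendsto_Lp hf).exists_seq_tendsto_ae
  obtain ⟨ms, hms, hga⟩ := (tendstoInMeasure_of_tendsto_Lp
    (hg.comp hns.tendsto_atTop)).exists_seq_tendsto_ae
  have hw : ∀ᵐ x, ∀ n, (p n).2 x = (w x : ℂ) * (p n).1 x :=
    ae_all_iff.mpr fun n => mem_graph_mulOp_iff.mp (hp n)
  refine mem_graph_mulOp_iff.mpr ?_
  filter_upwards [hfa, hga, hw] with x h1 h2 h3
  refine tendsto_nhds_unique h2 ?_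
  refine ((h1.comp hms.tendsto_atTop).const_mul (w x : ℂ)).congr fun n => ?_
  exact (h3 _).symm

theorem mem_graph_fourierMulOp_iff {w : Space d → ℝ} {f g : L2 d} :
    (f, g) ∈ (fourierMulOp d w).graph ↔
      (Lp.fourierTransformₗᵢ (Space d) ℂ f, Lp.fourierTransformₗᵢ (Space d) ℂ g) ∈
        (mulOp d w).graph := by
  set F := Lp.fourierTransformₗᵢ (Space d) ℂ with hF
  rw [LinearPMap.mem_graph_iff, LinearPMap.mem_graph_iff]
  constructor
  · rintro ⟨y, rfl, hy⟩
    refine ⟨⟨F y, y.2⟩, rfl, ?_⟩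
    change F.symm (mulOp d w ⟨F y, y.2⟩) = g at hy
    rw [← hy, LinearIsometryEquiv.apply_symm_apply]
  · rintro ⟨y, hy, hy'⟩
    refine ⟨⟨f, ?_⟩, rfl, ?_⟩
    · change (y : L2 d) = F f at hy
      change F f ∈ (mulOp d w).domain
      rw [← hy]
      exact y.2
    · obtain ⟨y, hyd⟩ := y
      change y = F f at hy
      subst hy
      change F.symm (mulOp d w ⟨F f, hyd⟩) = g
      rw [hy', LinearIsometryEquiv.symm_apply_apply]

theorem isClosed_fourierMulOp (w : Space d → ℝ) : (fourierMulOp d w).IsClosed := by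
  set F := Lp.fourierTransformₗᵢ (Space d) ℂ with hF
  have hc : Continuous fun p : L2 d × L2 d => (F p.1, F p.2) :=
    (F.continuous.comp continuous_fst).prodMk (F.continuous.comp continuous_snd)
  have h := (isClosed_mulOp w).preimage hc
  have he : ((fourierMulOp d w).graph : Set (L2 d × L2 d)) =
      (fun p => (F p.1, F p.2)) ⁻¹' (mulOp d w).graph :=
    Set.ext fun p => mem_graph_fourierMulOp_iff
  change _root_.IsClosed ((fourierMulOp d w).graph : Set (L2 d × L2 d))
  rw [he]
  exact h

end Multiplication

/-! ### The Fourier transform of a ladder family. -/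

section FourierLadder

variable {d : ℕ}

theorem partialDeriv_fourier (j : Fin d) (φ : 𝓢(Space d, ℂ)) :
    partialDeriv d j (𝓕 φ) = (-(2 * Real.pi * Complex.I)) • 𝓕 (position d j φ) := by
  have h := lineDerivOp_fourier_eq φ (EuclideanSpace.single j (1 : ℝ))
  refine h.trans ?_
  rw [FourierTransform.fourier_smul]
  congr 2
  ext x
  rw [position_apply, smulLeftCLM_apply_apply (by fun_prop)]
  simp [EuclideanSpace.inner_single_right]

theorem fourier_partialDeriv (j : Fin d) (φ : 𝓢(Space d, ℂ)) :
    𝓕 (partialDeriv d j φ) = (2 * Real.pi * Complex.I) • position d j (𝓕 φ) := by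
  have h := fourier_lineDerivOp_eq φ (EuclideanSpace.single j (1 : ℝ))
  refine h.trans ?_
  congr 1
  ext x
  rw [position_apply, smulLeftCLM_apply_apply (by fun_prop)]
  simp [EuclideanSpace.inner_single_right]

theorem lowering_fourier (s t : ℝ) (j : Fin d) (φ : 𝓢(Space d, ℂ)) :
    lowering (2 * Real.pi * t) (s / (2 * Real.pi)) j (𝓕 φ) =
      (-Complex.I) • 𝓕 (lowering s t j φ) := by
  have hπ : (Real.pi : ℂ) ≠ 0 := by exact_mod_cast Real.pi_ne_zero
  rw [lowering_apply, lowering_apply, partialDeriv_fourier, FourierTransform.fourier_add,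
    FourierTransform.fourier_smul, FourierTransform.fourier_smul, fourier_partialDeriv]
  simp only [smul_add, smul_smul]
  rw [add_comm]
  congr 2
  · push_cast
    field_simp
  · push_cast
    linear_combination (2 * Real.pi * t : ℂ) * Complex.I_sq

theorem raising_fourier (s t : ℝ) (j : Fin d) (φ : 𝓢(Space d, ℂ)) :
    raising (2 * Real.pi * t) (s / (2 * Real.pi)) j (𝓕 φ) =
      Complex.I • 𝓕 (raising s t j φ) := by
  have hπ : (Real.pi : ℂ) ≠ 0 := by exact_mod_cast Real.pi_ne_zero
  rw [raising_apply, raising_apply, partialDeriv_fourier, sub_eq_add_neg, sub_eq_add_neg,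
    ← neg_smul, ← neg_smul, FourierTransform.fourier_add, FourierTransform.fourier_smul,
    FourierTransform.fourier_smul, fourier_partialDeriv]
  simp only [smul_add, smul_smul]
  rw [add_comm]
  congr 2
  · push_cast
    field_simp
  · push_cast
    linear_combination (2 * Real.pi * t : ℂ) * Complex.I_sq

/-- Up to factors `2πi`, the Fourier transform exchanges `x_j` and `∂_j`, hence the roles of `s` and
`t`, and lowering picks up the phase `-i`. This is why `IsLadder` carries `ω`. -/
theorem IsLadder.fourier {s t : ℝ} {ω : ℂ} {u : (Fin d → ℕ) → 𝓢(Space d, ℂ)}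
    (h : IsLadder s t ω u) :
    IsLadder (2 * Real.pi * t) (s / (2 * Real.pi)) (-Complex.I * ω) fun k => 𝓕 (u k) := by
  refine ⟨fun k => ?_, fun j k => ?_, fun j k => ?_⟩
  · rw [← h.norm_eq_one k]
    exact norm_fourier_toL2_eq (u k)
  · rw [lowering_fourier, h.lowering_eq, FourierTransform.fourier_smul, smul_smul]
    congr 1
    ring
  · rw [raising_fourier, h.raising_eq, FourierTransform.fourier_smul, smul_smul]
    congr 1
    simp only [map_mul, map_neg, Complex.conj_I, neg_neg]
    ring

theorem fourierTransform_schwartzIncl (φ : 𝓢(Space d, ℂ)) :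
    Lp.fourierTransformₗᵢ (Space d) ℂ (schwartzIncl d φ) = schwartzIncl d (𝓕 φ) :=
  SchwartzMap.toLp_fourier_eq φ

end FourierLadder


/-! ### Traces of powers against a diagonal state. -/

section Weight

variable {d : ℕ} {s t a r m : ℝ} {ω : ℂ} {u : (Fin d → ℕ) → 𝓢(Space d, ℂ)}

theorem schwartzIncl_coeFn (φ : 𝓢(Space d, ℂ)) : schwartzIncl d φ =ᵐ[volume] φ :=
  φ.coeFn_toLp 2 volume

theorem IsLadder.exists_weighted (hd : 1 ≤ d) (h : IsLadder s t ω u) (hs : 0 < s) (ht : 0 < t)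
    (ha : 0 < a) (hm : -(d : ℝ) < 2 * m) (k : Fin d → ℕ) :
    ∃ v : L2 d, (schwartzIncl d (u k), v) ∈ (mulOp d fun x => (a * ‖x‖) ^ m).graph ∧
      ‖v‖ ^ 2 = a ^ (2 * m) * ∫ x, ‖x‖ ^ (2 * m) * ‖u k x‖ ^ 2 ∧
      ⟪schwartzIncl d (u k), v⟫_ℂ = ((a ^ m * ∫ x, ‖x‖ ^ m * ‖u k x‖ ^ 2 : ℝ) : ℂ) := by
  have hsq (x : Space d) : ‖(((a * ‖x‖) ^ m : ℝ) : ℂ) * u k x‖ ^ 2 =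
      a ^ (2 * m) * (‖x‖ ^ (2 * m) * ‖u k x‖ ^ 2) := by
    have hax : 0 ≤ a * ‖x‖ := by positivity
    rw [norm_mul, mul_pow, Complex.norm_real, Real.norm_of_nonneg (Real.rpow_nonneg hax _),
      ← Real.rpow_two ((a * ‖x‖) ^ m), ← Real.rpow_mul hax, mul_comm m,
      Real.mul_rpow ha.le (norm_nonneg x), mul_assoc]
  have hmeas : AEStronglyMeasurable (fun x => (((a * ‖x‖) ^ m : ℝ) : ℂ) * u k x) volume := by
    refine AEStronglyMeasurable.mul ?_ (u k).continuous.aestronglyMeasurable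
    exact (Complex.measurable_ofReal.comp
      ((measurable_norm.const_mul a).pow_const m)).aestronglyMeasurable
  have hLp : MemLp (fun x => (((a * ‖x‖) ^ m : ℝ) : ℂ) * u k x) 2 volume := by
    rw [memLp_two_iff_integrable_sq_norm hmeas]
    simp only [hsq]
    -- Integrability for a single `k` does not involve `r`; the value `1/2` is an arbitrary
    -- admissible choice.
    exact ((h.hasSum_integral_norm_rpow hd hs ht one_half_pos one_half_lt_one hm).1 k).const_mul _
  refine ⟨hLp.toLp _, ?_, ?_, ?_⟩
  · rw [mem_graph_mulOp_iff]
    filter_upwards [hLp.coeFn_toLp, schwartzIncl_coeFn (u k)] with x h1 h2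
    rw [h1, h2]
  · have h1 := inner_self_eq_norm_sq_to_K (𝕜 := ℂ) (hLp.toLp _)
    rw [L2.inner_def] at h1
    have h2 : ∫ x, ⟪hLp.toLp _ x, hLp.toLp _ x⟫_ℂ =
        ((a ^ (2 * m) * ∫ x, ‖x‖ ^ (2 * m) * ‖u k x‖ ^ 2 : ℝ) : ℂ) := by
      rw [← integral_const_mul, ← integral_complex_ofReal]
      refine integral_congr_ae ?_
      filter_upwards [hLp.coeFn_toLp] with x h3
      rw [h3, inner_self_eq_norm_sq_to_K, ← hsq]
      simp only [Complex.coe_algebraMap, Complex.ofReal_pow]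
    rw [h2] at h1
    simp only [Complex.coe_algebraMap] at h1
    exact_mod_cast h1.symm
  · rw [L2.inner_def, ← integral_const_mul, ← integral_complex_ofReal]
    refine integral_congr_ae ?_
    filter_upwards [hLp.coeFn_toLp, schwartzIncl_coeFn (u k)] with x h1 h2
    rw [h1, h2, RCLike.inner_apply, mul_assoc, Complex.mul_conj',
      Real.mul_rpow ha.le (norm_nonneg x)]
    push_cast
    ring

/-- The bound `‖v‖ ≤ 1 + ‖v‖²` reduces this to the geometric series and the convergent moment
series. -/
theorem IsLadder.summable_pow_mul_norm (hd : 1 ≤ d) (h : IsLadder s t ω u) (hs : 0 < s)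
    (ht : 0 < t) (h0 : 0 < r) (h1 : r < 1) (hm : -(d : ℝ) < 2 * m) {v : (Fin d → ℕ) → L2 d}
    (hv : ∀ k, ‖v k‖ ^ 2 = a ^ (2 * m) * ∫ x, ‖x‖ ^ (2 * m) * ‖u k x‖ ^ 2) :
    Summable fun k => r ^ (∑ i, k i) * ‖v k‖ := by
  have hs1 := (h.hasSum_integral_norm_rpow hd hs ht h0 h1 hm).2.summable.mul_left (a ^ (2 * m))
  refine ((summable_pow_sum d h0.le h1).add hs1).of_nonneg_of_le (fun k => by positivity)
    fun k => ?_
  have h2 : ‖v k‖ ≤ 1 + ‖v k‖ ^ 2 := by nlinarith [sq_nonneg (‖v k‖ - 1), norm_nonneg (v k)]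
  calc r ^ (∑ i, k i) * ‖v k‖ ≤ r ^ (∑ i, k i) * (1 + ‖v k‖ ^ 2) := by gcongr
    _ = _ := by rw [hv]; ring

variable {b : HilbertBasis (Fin d → ℕ) ℂ (L2 d)} {F : L2 d ≃ₗᵢ[ℂ] L2 d} {R : L2 d →ₗ.[ℂ] L2 d}
  {G : L2 d →L[ℂ] L2 d} {A : ℝ}

/-- Position and momentum together: `F` is the identity with `a = 1`, or the Fourier transform with
`a = h`. The square root of the state has weights `√r ^ |k|`, again geometric with ratio below one.
-/
theorem IsLadder.hasSymmTraceMul (hd : 1 ≤ d) (h : IsLadder s t ω u) (hs : 0 < s) (ht : 0 < t)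
    (hb : ∀ k, F (b k) = schwartzIncl d (u k)) (hR : R.IsClosed) (ha : 0 < a)
    (hm : -(d : ℝ) < 2 * m)
    (hRF : ∀ f g, (F f, F g) ∈ (mulOp d fun x => (a * ‖x‖) ^ m).graph → (f, g) ∈ R.graph)
    (hA : 0 ≤ A) (h0 : 0 < r) (h1 : r < 1)
    (hG : ∀ k, G (b k) = ((A * r ^ (∑ i, k i) : ℝ) : ℂ) • b k) :
    HasSymmTraceMul R G ((A * a ^ (2 * m) * ((∑' k : Fin d → ℕ, r ^ (∑ i, k i)) *
      (Real.Gamma (((d : ℝ) + 2 * m) / 2) / Real.Gamma ((d : ℝ) / 2) *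
        (s / t * ((1 - r) / (1 + r))) ^ (-(2 * m) / 2))) : ℝ) : ℂ) := by
  choose v hv hvn _ using h.exists_weighted hd hs ht ha hm
  have hsqrt (k : Fin d → ℕ) : √(A * r ^ (∑ i, k i)) = √A * √r ^ (∑ i, k i) := by
    rw [Real.sqrt_mul hA]
    congr 1
    refine (Real.sqrt_eq_iff_mul_self_eq (by positivity) (by positivity)).mpr ?_
    rw [← mul_pow, Real.mul_self_sqrt h0.le]
  have h0' : 0 < √r := Real.sqrt_pos.mpr h0
  have h1' : √r < 1 := by rwa [Real.sqrt_lt' one_pos, one_pow]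
  refine hasSymmTraceMul_of_diagonal b hR (v := fun k => F.symm (v k))
    (fun k => by positivity) hG ?_ (fun k => ?_) ?_ ?_
  · simp only [hsqrt]
    exact (summable_pow_sum d h0'.le h1').mul_left _
  · apply hRF
    rw [F.apply_symm_apply, hb]
    exact hv k
  · simp only [hsqrt, LinearIsometryEquiv.norm_map, mul_assoc]
    exact (h.summable_pow_mul_norm hd hs ht h0' h1' hm hvn).mul_left _
  · have := (h.hasSum_integral_norm_rpow hd hs ht h0 h1 hm).2.mul_left (A * a ^ (2 * m))
    refine (congrArg (HasSum · _) (funext fun k => ?_)).mp this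
    rw [LinearIsometryEquiv.norm_map, hvn]
    ring

/-- Two exponents occur: `2 m` decides whether the weighted eigenfunctions lie in `L²`, while the
trace itself is the moment of order `m`. -/
theorem IsLadder.hasTraceMul (hd : 1 ≤ d) (h : IsLadder s t ω u) (hs : 0 < s) (ht : 0 < t)
    (hb : ∀ k, F (b k) = schwartzIncl d (u k)) (hR : R.IsClosed) (ha : 0 < a)
    (hm : -(d : ℝ) < m) (hm2 : -(d : ℝ) < 2 * m)
    (hRF : ∀ f g, (F f, F g) ∈ (mulOp d fun x => (a * ‖x‖) ^ m).graph → (f, g) ∈ R.graph)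
    (hA : 0 ≤ A) (h0 : 0 < r) (h1 : r < 1)
    (hG : ∀ k, G (b k) = ((A * r ^ (∑ i, k i) : ℝ) : ℂ) • b k) :
    HasTraceMul R G ((A * a ^ m * ((∑' k : Fin d → ℕ, r ^ (∑ i, k i)) *
      (Real.Gamma (((d : ℝ) + m) / 2) / Real.Gamma ((d : ℝ) / 2) *
        (s / t * ((1 - r) / (1 + r))) ^ (-m / 2))) : ℝ) : ℂ) := by
  choose v hv hvn hvi using h.exists_weighted hd hs ht ha hm2
  have habs (k : Fin d → ℕ) : |A * r ^ (∑ i, k i)| = A * r ^ (∑ i, k i) :=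
    abs_of_nonneg (by positivity)
  refine hasTraceMul_of_diagonal b hR (v := fun k => F.symm (v k)) hG ?_ (fun k => ?_) ?_ ?_
  · simp only [habs]
    exact (summable_pow_sum d h0.le h1).mul_left _
  · apply hRF
    rw [F.apply_symm_apply, hb]
    exact hv k
  · simp only [habs, LinearIsometryEquiv.norm_map, mul_assoc]
    exact (h.summable_pow_mul_norm hd hs ht h0 h1 hm2 hvn).mul_left _
  · have := (h.hasSum_integral_norm_rpow hd hs ht h0 h1 hm).2.mul_left (A * a ^ m)
    refine (congrArg (HasSum · _) (funext fun k => ?_)).mp (Complex.hasSum_ofReal.mpr this)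
    rw [← F.inner_map_map, F.apply_symm_apply, hb, hvi]
    push_cast
    ring

end Weight

/-! ### The thermal state in the Hermite basis, and the theorem. -/

section Thermal

/-- The zero-point factor `exp (-βħd/2)` occurs in both `expNeg` and its trace, and cancels. -/
theorem thermalState_apply {d : ℕ} {ħ β : ℝ} (hħ : 0 < ħ) (hβ : 0 < β)
    {b : HilbertBasis (Fin d → ℕ) ℂ (L2 d)} {u : (Fin d → ℕ) → 𝓢(Space d, ℂ)}
    (hb : ∀ k, b k = schwartzIncl d (u k))
    (hu : ∀ k, oscillatorSchwartz d ħ (u k) = ((ħ * ((∑ j, k j : ℕ) + d / 2) : ℝ) : ℂ) • u k)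
    (k : Fin d → ℕ) :
    thermalState d ħ β (b k) = (((planck ħ ^ d * ∑' j : Fin d → ℕ,
      Real.exp (-(β * ħ)) ^ (∑ i, j i))⁻¹ * Real.exp (-(β * ħ)) ^ (∑ i, k i) : ℝ) : ℂ) • b k := by
  set r := Real.exp (-(β * ħ)) with hr
  have hr1 : r < 1 := Real.exp_lt_one_iff.mpr (neg_neg_of_pos (mul_pos hβ hħ))
  set e : (Fin d → ℕ) → ℝ := fun k => ħ * ((∑ j, k j : ℕ) + d / 2) with he
  set ε := Real.exp (-(β * ħ * d / 2)) with hε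
  have hexp (k : Fin d → ℕ) : Real.exp (-β * e k) = ε * r ^ (∑ i, k i) := by
    rw [hε, hr, ← Real.exp_nat_mul, ← Real.exp_add]
    congr 1
    simp only [he]
    ring
  have hsum : Summable fun k => Real.exp (-β * e k) := by
    simp only [hexp]
    exact (summable_pow_sum d (Real.exp_pos _).le hr1).mul_left _
  have hG := expNeg_hamiltonian_apply b hb hu hsum
  have hnorm (k : Fin d → ℕ) : ‖expNeg β (hamiltonian d ħ) (b k)‖ = Real.exp (-β * e k) := by
    rw [hG, norm_smul, b.orthonormal.norm_eq_one, mul_one, Complex.norm_real,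
      Real.norm_of_nonneg (Real.exp_pos _).le]
  have htr : trace (expNeg β (hamiltonian d ħ)) =
      ((ε * ∑' k : Fin d → ℕ, r ^ (∑ i, k i) : ℝ) : ℂ) := by
    rw [trace_eq b (hasTrace_of_summable b (by simpa only [hnorm] using hsum)), ← tsum_mul_left,
      Complex.ofReal_tsum]
    refine tsum_congr fun k => ?_
    rw [hG, inner_smul_right, inner_self_eq_norm_sq_to_K, b.orthonormal.norm_eq_one, hexp]
    simp
  have hε0 : (ε : ℂ) ≠ 0 := by exact_mod_cast (Real.exp_pos _).ne'
  rw [thermalState, smul_apply, hG, smul_smul, partitionFunction, htr, hexp]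
  congr 1
  push_cast
  field_simp

theorem one_sub_exp_neg_div (x : ℝ) :
    (1 - Real.exp (-x)) / (1 + Real.exp (-x)) = Real.tanh (x / 2) := by
  rw [Real.tanh_eq_sinh_div_cosh, Real.sinh_eq, Real.cosh_eq,
    show Real.exp (-x) = Real.exp (-(x / 2)) * Real.exp (-(x / 2)) by
      rw [← Real.exp_add]; ring_nf]
  have h1 : Real.exp (x / 2) * Real.exp (-(x / 2)) = 1 := by rw [← Real.exp_add]; simp
  have h2 := Real.exp_pos (x / 2)
  have h3 := Real.exp_pos (-(x / 2))
  rw [div_div_div_cancel_right₀ two_ne_zero, div_eq_div_iff (by positivity) (by positivity)]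
  linear_combination (-2 * Real.exp (-(x / 2))) * h1

end Thermal

end ThermalState

end

open ThermalState in
theorem lemma2p7 (d : ℕ) (hd : 1 ≤ d) (ħ β n : ℝ) (hħ : 0 < ħ) (hβ : 0 < β)
    (hn : -(d : ℝ) < n) :
    ∃ τ : ℝ,
      planck ħ ^ d * τ =
        Real.Gamma (((d : ℝ) + n) / 2) / Real.Gamma ((d : ℝ) / 2) *
          (β * theta (β * ħ / 2) / 2) ^ (-n / 2) ∧
      HasSymmTraceMul (absPositionPow d (n / 2)) (thermalState d ħ β) (τ : ℂ) ∧
      HasSymmTraceMul (absMomentumPow d ħ (n / 2)) (thermalState d ħ β) (τ : ℂ) ∧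
      (-(d : ℝ) / 2 < n →
        HasTraceMul (absPositionPow d n) (thermalState d ħ β) (τ : ℂ) ∧
        HasTraceMul (absMomentumPow d ħ n) (thermalState d ħ β) (τ : ℂ)) := by
  set r := Real.exp (-(β * ħ)) with hr
  have hr0 : 0 < r := Real.exp_pos _
  have hr1 : r < 1 := Real.exp_lt_one_iff.mpr (neg_neg_of_pos (mul_pos hβ hħ))
  have hr1' : 0 < 1 - r := sub_pos.mpr hr1
  -- The solution of `t = ħ s` and `2 s t = 1`.
  set s := (√(2 * ħ))⁻¹ with hsdef
  have hs : 0 < s := inv_pos.mpr (Real.sqrt_pos.mpr (by positivity))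
  have ht : 0 < ħ * s := by positivity
  have hss : s * s * (2 * ħ) = 1 := by
    rw [hsdef, ← mul_inv, Real.mul_self_sqrt (by positivity)]
    exact inv_mul_cancel₀ (by positivity)
  have hst : 2 * s * (ħ * s) = 1 := by linear_combination hss
  have hg : 0 < s / (2 * (ħ * s)) := by positivity
  have hu := isLadder_hermite (d := d) ht hst hg
  have huF := hu.fourier
  set u := hermite d s (ħ * s) hg
  set b := hermiteBasis d hs ht hst hg
  have hb (k : Fin d → ℕ) : b k = schwartzIncl d (u k) := hermiteBasis_apply ..
  have hbF (k : Fin d → ℕ) :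
      Lp.fourierTransformₗᵢ (Space d) ℂ (b k) = schwartzIncl d (𝓕 (u k)) := by
    rw [hb, fourierTransform_schwartzIncl]
  have hG := thermalState_apply hħ hβ hb (hu.oscillatorSchwartz_eq rfl hst)
  rw [← hr] at hG
  set Z := ∑' k : Fin d → ℕ, r ^ (∑ i, k i) with hZdef
  have hZ : 0 < Z := (summable_pow_sum d hr0.le hr1).tsum_pos (fun k => by positivity) 0
    (by positivity)
  have hh : 0 < planck ħ := by unfold planck; positivity
  have hA : 0 ≤ (planck ħ ^ d * Z)⁻¹ := by positivity
  set κ := s / (ħ * s) * ((1 - r) / (1 + r)) with hκdef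
  have hκ : 0 < κ := by positivity
  have hs' : 0 < 2 * Real.pi * (ħ * s) := by positivity
  have ht' : 0 < s / (2 * Real.pi) := by positivity
  -- In the Fourier variable the Gaussian rate is `h² κ`; the weight `(h |ξ|)^m` compensates through
  -- `hpow`, so both traces agree.
  have hκF : 2 * Real.pi * (ħ * s) / (s / (2 * Real.pi)) * ((1 - r) / (1 + r)) =
      planck ħ ^ 2 * κ := by
    rw [hκdef, planck]
    field_simp
  -- Both sides equal `tanh (βħ/2) / ħ`.
  have hκθ : β * theta (β * ħ / 2) / 2 = κ := by
    rw [hκdef, hr, one_sub_exp_neg_div, theta]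
    field_simp
  have hpow (m : ℝ) : planck ħ ^ m * (planck ħ ^ 2 * κ) ^ (-m / 2) = κ ^ (-m / 2) := by
    rw [Real.mul_rpow (by positivity) hκ.le, ← Real.rpow_natCast, ← Real.rpow_mul hh.le,
      ← mul_assoc, ← Real.rpow_add hh]
    rw [show m + ((2 : ℕ) : ℝ) * (-m / 2) = 0 by push_cast; ring, Real.rpow_zero, one_mul]
  have hw (m : ℝ) : (fun x : Space d => ‖x‖ ^ m) = fun x => (1 * ‖x‖) ^ m := by simp only [one_mul]
  have hwF (m : ℝ) : (fun x : Space d => ‖(2 * Real.pi * ħ) • x‖ ^ m) =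
      fun x => (planck ħ * ‖x‖) ^ m := by
    funext x
    rw [norm_smul, ← planck, Real.norm_of_nonneg hh.le]
  have hR (m : ℝ) (f g : L2 d) (hfg : (LinearIsometryEquiv.refl ℂ _ f,
      LinearIsometryEquiv.refl ℂ _ g) ∈ (mulOp d fun x => (1 * ‖x‖) ^ m).graph) :
      (f, g) ∈ (absPositionPow d m).graph := by
    rw [absPositionPow, hw]
    exact hfg
  have hRF (m : ℝ) (f g : L2 d) (hfg : (Lp.fourierTransformₗᵢ (Space d) ℂ f,
      Lp.fourierTransformₗᵢ (Space d) ℂ g) ∈ (mulOp d fun x => (planck ħ * ‖x‖) ^ m).graph) :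
      (f, g) ∈ (absMomentumPow d ħ m).graph := by
    rw [absMomentumPow, hwF, mem_graph_fourierMulOp_iff]
    exact hfg
  set Γr := Real.Gamma (((d : ℝ) + n) / 2) / Real.Gamma ((d : ℝ) / 2) with hΓr
  have hn2 : 2 * (n / 2) = n := by ring
  have hm : -(d : ℝ) < 2 * (n / 2) := by rwa [hn2]
  have hval : (planck ħ ^ d * Z)⁻¹ * 1 ^ n * (Z * (Γr * κ ^ (-n / 2))) =
      (planck ħ ^ d)⁻¹ * (Γr * κ ^ (-n / 2)) := by
    rw [Real.one_rpow]
    field_simp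
  have hvalF : (planck ħ ^ d * Z)⁻¹ * planck ħ ^ n *
      (Z * (Γr * (planck ħ ^ 2 * κ) ^ (-n / 2))) =
      (planck ħ ^ d)⁻¹ * (Γr * κ ^ (-n / 2)) := by
    rw [← hpow n]
    field_simp
  refine ⟨(planck ħ ^ d)⁻¹ * (Γr * κ ^ (-n / 2)), ?_, ?_, ?_, fun hnd => ⟨?_, ?_⟩⟩
  · rw [hκθ, mul_inv_cancel_left₀ (by positivity)]
  · have := hu.hasSymmTraceMul hd hs ht (F := LinearIsometryEquiv.refl ℂ _) hb
      (isClosed_mulOp _) one_pos hm (hR _) hA hr0 hr1 hG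
    rwa [hn2, ← hκdef, hval] at this
  · have := huF.hasSymmTraceMul hd hs' ht' hbF (isClosed_fourierMulOp _) hh hm (hRF _) hA hr0 hr1 hG
    rwa [hn2, hκF, hvalF] at this
  · have := hu.hasTraceMul hd hs ht (F := LinearIsometryEquiv.refl ℂ _) hb
      (isClosed_mulOp _) one_pos hn (by linarith) (hR _) hA hr0 hr1 hG
    rwa [← hκdef, hval] at this
  · have := huF.hasTraceMul hd hs' ht' hbF (isClosed_fourierMulOp _) hh hn (by linarith) (hRF _)
      hA hr0 hr1 hG
    rwa [hκF, hvalF] at this
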